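/- **Theorem 5.2.** Let $L=\langle 0,1,+,\cdot,\le\rangle$ be the language of arithmetic. $I\Sigma_1$ is Robinson arithmetic together with induction for all $\Sigma_1$-formulas (with parameters). "$T$ proves $\varphi$" means that $\varphi$ holds in all models of the first-order theory $T$ (equivalently, by the completeness theorem, that $\varphi$ is derivable from $T$). Let $L^e=\langle 0,1,+,\cdot,e,\le\rangle$ be the extension of $L$ by a symbol $e$ for a partial binary function (given in first-order logic by its graph). Let $\mathrm{Exp}'$ be the following $L^e$-axioms for a structure $\langle\mathcal B,e\rangle$: * (e0) $e:B\times A\to B$ for some $L$-substructure $\mathcal A$ of $\mathcal B$ which satisfies Presburger arithmetic, i.e. (with all quantifiers ranging over $A$) $0\ne z+1$; $x\neq0\to\exists z\,(x=z+1)$; $x+z=y+z\to x=y$; $x+0=x$; $x+(y+z)=(x+y)+z$; $x+y=y+x$; $x\le y\leftrightarrow\exists z\,(x+z=y)$; and, for every standard $k>0$, $\exists y\,(ky\le x<k(y+1))$, where $ky=y+\dots+y$ ($k$ times); and, for all $x\in B$ and $y,z\in A$, * (e1) $(x=1\vee y=0)\leftrightarrow e(x,y)=1$; * (e2) $x\ne0\to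 e(x,y)\neq0$; * (e3) $e(x,1)=x$; * (e4) $e(x,y+z)=e(x,y)\cdot e(x,z)$. Catalan's conjecture for an exponential $\exp$ is the sentence: for all $a,b,m,n>1$, [$\exp(a,n)$ and $\exp(b,m)$ are defined and $\exp(a,n)-\exp(b,m)=1$] if and only if $a=m=3$ and $b=n=2$. The definable exponential $x^y$ is given by its usual definition in arithmetic: $x^y=z$ iff there is a sequence $s$, coded by Gödel's $\beta$-function, with $s_0=1$, $s_{i+1}=s_i\cdot x$ for all $i<y$, and $s_y=z$. For $x\neq 0$, $\mathrm{rad}(x)$ is the product of the distinct primes dividing $x$, i.e. the squarefree number with the same prime divisors as $x$. Let $S$ be an $L$-theory which proves all of $I\Sigma_1$, which for some standard $K\in\mathbb N$ proves $$a,b,c>0\ \wedge\ a,b,c\text{ coprime}\ \wedge\ a+b=c\ \longrightarrow\ c<K\,\mathrm{rad}(abc)^{1+1/3}$$ (written without roots as $c^3<K^3\,\mathrm{rad}(abc)^4$), and which proves Catalan's conjecture for the definable exponential $x^y$. Then: 1. $S+\mathrm{Exp}'$ proves Catalan's conjecture for $e$. Consequently it holds in every model $\langle\mathcal B,e\rangle$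 of $S+\mathrm{Exp}'$, and also in every substructure of such a model which is closed under $e$ and on which $e$ is total. 2. In particular, take $S=\mathrm{Th}(\mathbb N)$, the set of all $L$-sentences true in $\mathbb N$. Suppose that the ABC inequality with exponent $1+1/3$ holds in $\mathbb N$ for some $K\in\mathbb N$, i.e. $c<K\,\mathrm{rad}(abc)^{1+1/3}$ for all coprime positive integers $a,b$ and $c=a+b$. Then, in every model $\langle\mathcal B,e\rangle$ of $\mathrm{Th}(\mathbb N)+\mathrm{Exp}'$ and in every substructure of it that is closed under $e$ and on which $e$ is total, Catalan's conjecture for $e$ holds if and only if Catalan's conjecture ($a^n-b^m=1$ with $a,b,m,n>1$ only for $a=m=3$, $b=n=2$) holds in $\mathbb N$. (The latter is Mihăilescu's theorem.) -/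

import Mathlib

namespace WeakExp

open FirstOrder FirstOrder.Language

/-! ### The language of arithmetic `⟨0, 1, +, ·, ≤⟩` -/

inductive ArithFunc : ℕ → Type
  | zero : ArithFunc 0
  | one : ArithFunc 0
  | add : ArithFunc 2
  | mul : ArithFunc 2

inductive ArithRel : ℕ → Type
  | le : ArithRel 2

/-- The language `L = ⟨0, 1, +, ·, ≤⟩`. -/
def arith : FirstOrder.Language.{0, 0} := ⟨ArithFunc, ArithRel⟩

abbrev zeroFunc : arith.Functions 0 := ArithFunc.zero
abbrev oneFunc : arith.Functions 0 := ArithFunc.one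
abbrev addFunc : arith.Functions 2 := ArithFunc.add
abbrev mulFunc : arith.Functions 2 := ArithFunc.mul
abbrev leRel : arith.Relations 2 := ArithRel.le

/-- The standard model: the natural numbers as an `L`-structure. -/
instance : arith.Structure ℕ where
  funMap := fun {_} f => match f with
    | ArithFunc.zero => fun _ => 0
    | ArithFunc.one => fun _ => 1
    | ArithFunc.add => fun x => x 0 + x 1
    | ArithFunc.mul => fun x => x 0 * x 1
  RelMap := fun {_} r => match r with
    | ArithRel.le => fun x => x 0 ≤ x 1

section Terms
variable {α : Type}

instance : Zero (arith.Term α) := ⟨Constants.term zeroFunc⟩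
instance : One (arith.Term α) := ⟨Constants.term oneFunc⟩
instance : Add (arith.Term α) := ⟨addFunc.apply₂⟩
instance : Mul (arith.Term α) := ⟨mulFunc.apply₂⟩

/-- The `k`-fold sum `t + ⋯ + t`. -/
def nmul : ℕ → arith.Term α → arith.Term α
  | 0, _ => 0
  | k + 1, t => nmul k t + t

/-- The numeral of a standard natural number. -/
def num (k : ℕ) : arith.Term α := nmul k 1

/-- The `k`-fold product `t · ⋯ · t`, for a standard `k`. -/
def npow (t : arith.Term α) : ℕ → arith.Term α
  | 0 => 1
  | k + 1 => npow t k * t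

/-- A term, read in a context with one more bound variable. -/
def up {n : ℕ} (t : arith.Term (α ⊕ Fin n)) : arith.Term (α ⊕ Fin (n + 1)) :=
  t.relabel (Sum.map id Fin.castSucc)

/-- The innermost bound variable of a context. -/
def last (n : ℕ) : arith.Term (α ⊕ Fin (n + 1)) := &(Fin.last n)

/-! ### Formulas of the language of arithmetic

In a formula with `n` bound variables these are `&0, …, &(n-1)`, and a quantifier in front of
it binds the last of them. -/

variable {n : ℕ}

def le (t u : arith.Term (α ⊕ Fin n)) : arith.BoundedFormula α n :=
  leRel.boundedFormula₂ t u

def lt (t u : arith.Term (α ⊕ Fin n)) : arith.BoundedFormula α n :=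
  le t u ⊓ ∼(t =' u)

/-- `t` divides `u`. -/
def dvd (t u : arith.Term (α ⊕ Fin n)) : arith.BoundedFormula α n :=
  ∃' ((up t * last n) =' up u)

/-- `p` is a prime. -/
def prime (p : arith.Term (α ⊕ Fin n)) : arith.BoundedFormula α n :=
  lt 1 p ⊓ ∀' (dvd (last n) (up p) ⟹ ((last n =' 1) ⊔ (last n =' up p)))

/-- `r` is the radical of `x` (for `x ≠ 0`), the product of the distinct primes dividing `x`:
`r` is squarefree, and its prime divisors are exactly those of `x`. -/
def isRad (r x : arith.Term (α ⊕ Fin n)) : arith.BoundedFormula α n :=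
  (∀' (dvd (last n * last n) (up r) ⟹ (last n =' 1))) ⊓
  ∀' (prime (last n) ⟹ (dvd (last n) (up r) ⇔ dvd (last n) (up x)))

/-- `a`, `b`, `c` have no common divisor other than `1`. -/
def coprime (a b c : arith.Term (α ⊕ Fin n)) : arith.BoundedFormula α n :=
  ∀' (dvd (last n) (up a) ⟹ dvd (last n) (up b) ⟹ dvd (last n) (up c) ⟹ (last n =' 1))

/-- Gödel's β-function, `β(c, d, i) = u`: the remainder of `c` modulo `1 + (i + 1) d` is `u`. -/
def beta (c d i u : arith.Term (α ⊕ Fin n)) : arith.BoundedFormula α n :=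
  lt u (1 + (i + 1) * d) ⊓ ∃' (up c =' (last n * (1 + (up i + 1) * up d) + up u))

/-- The graph `x ^ y = z` of the definable exponential: there is a coded sequence `s` such that
`s₀ = 1`, `sᵢ₊₁ = sᵢ · x` for all `i < y`, and `s_y = z`. -/
def expGraph (x y z : arith.Term (α ⊕ Fin n)) : arith.BoundedFormula α n :=
  -- the code `(c, d)` of the sequence is the pair of the next two bound variables
  let c : arith.Term (α ⊕ Fin (n + 2)) := up (last n)
  let d : arith.Term (α ⊕ Fin (n + 2)) := last (n + 1)
  ∃' ∃' (beta c d 0 1 ⊓ beta c d (up (up y)) (up (up z)) ⊓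
    ∀' (lt (last (n + 2)) (up (up (up y))) ⟹
      ∃' (beta (up (up c)) (up (up d)) (up (last (n + 2))) (last (n + 3)) ⊓
        beta (up (up c)) (up (up d)) (up (last (n + 2)) + 1)
          (last (n + 3) * up (up (up (up x)))))))

end Terms

/-! ### The theory `IΣ₁` -/

/-- Robinson arithmetic, with `x + 1` as the successor of `x`. -/
def robinson : arith.Theory :=
  { ((0 : arith.Term (Empty ⊕ Fin 0)) + 1) =' 1,
    ∀' ∼((&0 + 1) =' 0),
    ∀' ∀' (((&0 + 1) =' (&1 + 1)) ⟹ (&0 =' &1)),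
    ∀' (∼(&0 =' 0) ⟹ ∃' (&0 =' (&1 + 1))),
    ∀' ((&0 + 0) =' &0),
    ∀' ∀' ((&0 + (&1 + 1)) =' ((&0 + &1) + 1)),
    ∀' ((&0 * 0) =' 0),
    ∀' ∀' ((&0 * (&1 + 1)) =' (&0 * &1 + &0)),
    ∀' ∀' (le &0 &1 ⇔ ∃' ((&2 + &0) =' &1)) }

/-- Formulas all of whose quantifiers are bounded, that is, of the form `∀ x ≤ t` or `∃ x ≤ t`
with a term `t` in which `x` does not occur. -/
inductive IsDelta0 {α : Type} : ∀ {n : ℕ}, arith.BoundedFormula α n → Prop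
  | falsum {n : ℕ} : IsDelta0 (BoundedFormula.falsum (n := n))
  | equal {n : ℕ} (t u : arith.Term (α ⊕ Fin n)) : IsDelta0 (t =' u)
  | le {n : ℕ} (t u : arith.Term (α ⊕ Fin n)) : IsDelta0 (le t u)
  | imp {n : ℕ} {φ ψ : arith.BoundedFormula α n} : IsDelta0 φ → IsDelta0 ψ → IsDelta0 (φ ⟹ ψ)
  | ball {n : ℕ} (t : arith.Term (α ⊕ Fin n)) {φ : arith.BoundedFormula α (n + 1)} :
      IsDelta0 φ → IsDelta0 (∀' (WeakExp.le (last n) (up t) ⟹ φ))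
  | bex {n : ℕ} (t : arith.Term (α ⊕ Fin n)) {φ : arith.BoundedFormula α (n + 1)} :
      IsDelta0 φ → IsDelta0 (∃' (WeakExp.le (last n) (up t) ⊓ φ))

/-- `Σ₁`-formulas: a block of existential quantifiers in front of a formula with only bounded
quantifiers. -/
inductive IsSigma1 {α : Type} : ∀ {n : ℕ}, arith.BoundedFormula α n → Prop
  | delta0 {n : ℕ} {φ : arith.BoundedFormula α n} : IsDelta0 φ → IsSigma1 φ
  | ex {n : ℕ} {φ : arith.BoundedFormula α (n + 1)} : IsSigma1 φ → IsSigma1 (∃' φ)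

/-- The formula `φ(t)`, for `φ(x)` with parameters indexed by `Fin k` and the variable `x`
indexed by `Unit`. -/
def substVar {k : ℕ} (φ : arith.Formula (Fin k ⊕ Unit)) (t : arith.Term (Fin k ⊕ Unit)) :
    arith.Formula (Fin k ⊕ Unit) :=
  BoundedFormula.subst φ (Sum.elim (fun i => Term.var (Sum.inl i)) (fun _ => t))

/-- The induction axiom for `φ(x)`, universally closed over the parameters:
`φ(0) ∧ ∀ x (φ(x) → φ(x + 1)) → ∀ x φ(x)`. -/
noncomputable def induction {k : ℕ} (φ : arith.Formula (Fin k ⊕ Unit)) : arith.Sentence :=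
  Formula.iAlls (Fin k) (Formula.relabel Sum.inr
    ((Formula.iAlls Unit (substVar φ 0) ⊓
      Formula.iAlls Unit (φ ⟹ substVar φ (Term.var (Sum.inr ()) + 1))) ⟹
        Formula.iAlls Unit φ : arith.Formula (Fin k)))

/-- `IΣ₁`: Robinson arithmetic with induction for all `Σ₁`-formulas (with parameters). -/
def ISigma1 : arith.Theory :=
  robinson ∪
    {σ | ∃ (k : ℕ) (φ : arith.Formula (Fin k ⊕ Unit)), IsSigma1 φ ∧ σ = induction φ}

/-! ### Presburger arithmetic -/

/-- The axioms of Presburger arithmetic. -/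
def presburger : arith.Theory :=
  { ∀' ∼(0 =' (&0 + 1)),
    ∀' (∼(&0 =' 0) ⟹ ∃' (&0 =' (&1 + 1))),
    ∀' ∀' ∀' (((&0 + &2) =' (&1 + &2)) ⟹ (&0 =' &1)),
    ∀' ((&0 + 0) =' &0),
    ∀' ∀' ∀' ((&0 + (&1 + &2)) =' ((&0 + &1) + &2)),
    ∀' ∀' ((&0 + &1) =' (&1 + &0)),
    ∀' ∀' (le &0 &1 ⇔ ∃' ((&0 + &2) =' &1)) } ∪
  {σ | ∃ k : ℕ, 0 < k ∧ σ = ∀' ∃' (le (nmul k &1) &0 ⊓ lt &0 (nmul k (&1 + 1)))}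

/-! ### The language with an exponential -/

inductive ExpRel : ℕ → Type
  | graph : ExpRel 3

/-- The language with one ternary relation symbol, for the graph of a partial binary function. -/
def expSymbol : FirstOrder.Language.{0, 0} := ⟨fun _ => Empty, ExpRel⟩

/-- The language `Lᵉ = ⟨0, 1, +, ·, e, ≤⟩`; the partial function `e` is given by its graph. -/
abbrev arithExp : FirstOrder.Language.{0, 0} := arith.sum expSymbol

/-- The inclusion of `L` into `Lᵉ`. -/
abbrev incl : arith →ᴸ arithExp := LHom.sumInl

/-- The symbol for the graph of `e`, in the language `Lᵉ`. -/
abbrev expRel : arithExp.Relations 3 :=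
  LHom.sumInr.onRelation (ExpRel.graph : expSymbol.Relations 3)

section ExpFormulas
variable {α : Type} {n : ℕ}

/-- `e(t, u)` is defined and equal to `v`. -/
def E (t u v : arith.Term (α ⊕ Fin n)) : arithExp.BoundedFormula α n :=
  expRel.boundedFormula ![incl.onTerm t, incl.onTerm u, incl.onTerm v]

/-- `t` belongs to the set `A` of exponents: `e(x, t)` is defined for some `x`. -/
def inA (t : arith.Term (α ⊕ Fin n)) : arithExp.BoundedFormula α n :=
  ∃' ∃' E (up (last n)) (up (up t)) (last (n + 1))

/-- An equation between terms of `L`, as a formula of `Lᵉ`. -/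
def eq (t u : arith.Term (α ⊕ Fin n)) : arithExp.BoundedFormula α n :=
  incl.onBoundedFormula (t =' u)

/-- The relativization `φᴬ` of an `L`-formula: all quantifiers are restricted to `A`.
(`∃'` is `¬ ∀' ¬`, so existential quantifiers are restricted to `A`, too.) -/
def relativize : ∀ {n : ℕ}, arith.BoundedFormula α n → arithExp.BoundedFormula α n
  | _, .falsum => .falsum
  | _, .equal t u => incl.onBoundedFormula (.equal t u)
  | _, .rel R ts => incl.onBoundedFormula (.rel R ts)
  | _, .imp φ ψ => relativize φ ⟹ relativize ψ
  | n, .all φ => ∀' (inA (last n) ⟹ relativize φ)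

end ExpFormulas

/-- (e0): `e` is a function `B × A → B`, where `A` is the universe of an `L`-substructure of `B`
which satisfies the axioms of Presburger arithmetic. -/
def axE0 : arithExp.Theory :=
  { -- `e` is single-valued, and its domain is `B × A`
    ∀' ∀' ∀' ∀' (E &0 &1 &2 ⟹ E &0 &1 &3 ⟹ eq &2 &3),
    ∀' ∀' (inA &1 ⟹ ∃' E &0 &1 &2),
    -- `A` is closed under the operations of `L`
    inA 0,
    inA 1,
    ∀' ∀' (inA &0 ⟹ inA &1 ⟹ inA (&0 + &1)),
    ∀' ∀' (inA &0 ⟹ inA &1 ⟹ inA (&0 * &1)) } ∪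
  {σ | ∃ φ ∈ presburger, σ = relativize φ}

/-- (e1): `(x = 1 ∨ y = 0) ↔ e(x, y) = 1`. -/
def axE1 : arithExp.Sentence :=
  ∀' ∀' (inA &1 ⟹ ((eq &0 1 ⊔ eq &1 0) ⇔ E &0 &1 1))

/-- (e2): `x ≠ 0 → e(x, y) ≠ 0`. -/
def axE2 : arithExp.Sentence :=
  ∀' ∀' (inA &1 ⟹ ∼(eq &0 0) ⟹ ∼(E &0 &1 0))

/-- (e3): `e(x, 1) = x`. -/
def axE3 : arithExp.Sentence :=
  ∀' E &0 1 &0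

/-- (e4): `e(x, y + z) = e(x, y) · e(x, z)`. -/
def axE4 : arithExp.Sentence :=
  ∀' ∀' ∀' ∀' ∀' (E &0 &1 &3 ⟹ E &0 &2 &4 ⟹ E &0 (&1 + &2) (&3 * &4))

/-- `Exp'`: the axioms (e0) – (e4). -/
def ExpPrime : arithExp.Theory :=
  axE0 ∪ {axE1, axE2, axE3, axE4}

/-! ### The ABC inequality and Catalan's conjecture -/

/-- The ABC inequality with exponent `4/3` and constant `K`: if `a, b, c > 0` are coprime and
`a + b = c`, then `c < K rad(abc)^(4/3)`, that is, `c³ < K³ rad(abc)⁴`. -/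
def abc (K : ℕ) : arith.Sentence :=
  ∀' ∀' ∀' ∀' (lt 0 &0 ⟹ lt 0 &1 ⟹ lt 0 &2 ⟹ coprime &0 &1 &2 ⟹ ((&0 + &1) =' &2) ⟹
    isRad &3 (&0 * &1 * &2) ⟹ lt (npow &2 3) (npow (num K) 3 * npow &3 4))

/-- Catalan's conjecture for an exponential with graph `G`: for all `a, b, m, n > 1`,
`exp(a, n) - exp(b, m) = 1` if and only if `a = m = 3` and `b = n = 2`.
Here `a, b, m, n` are `&0, &1, &2, &3`, and `&4, &5` are the two powers. -/
def catalan {L' : FirstOrder.Language.{0, 0}} (ι : arith →ᴸ L')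
    (G : (t u v : arith.Term (Empty ⊕ Fin 6)) → L'.BoundedFormula Empty 6) : L'.Sentence :=
  ∀' ∀' ∀' ∀' (ι.onBoundedFormula (lt 1 &0 ⊓ lt 1 &1 ⊓ lt 1 &2 ⊓ lt 1 &3) ⟹
    ((∃' ∃' (G &0 &3 &4 ⊓ G &1 &2 &5 ⊓ ι.onBoundedFormula (&4 =' (&5 + 1)))) ⇔
      ι.onBoundedFormula
        ((&0 =' num 3) ⊓ (&2 =' num 3) ⊓ (&1 =' num 2) ⊓ (&3 =' num 2))))

/-- Catalan's conjecture for the definable exponential `x ^ y`. -/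
def catalanDef : arith.Sentence := catalan (LHom.id arith) expGraph

/-- Catalan's conjecture for `e`. -/
def catalanE : arithExp.Sentence := catalan incl E

/-- The theory `S + Exp'`, in the language `Lᵉ`. -/
def plusExp (S : arith.Theory) : arithExp.Theory := incl.onTheory S ∪ ExpPrime

/-- `S` is a theory stronger than `IΣ₁` which proves the ABC inequality with exponent `1 + 1/3`
for some standard `K`, and Catalan's conjecture for the definable exponential. Provability from
a first-order theory is `⊨ᵇ`, truth in all models (Gödel's completeness theorem). -/
def Admissible (S : arith.Theory) : Prop :=
  (∀ φ ∈ ISigma1, S ⊨ᵇ φ) ∧ (∃ K : ℕ, S ⊨ᵇ abc K) ∧ S ⊨ᵇ catalanDef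

/-- `e(x, y) = z` in a structure for `Lᵉ`. -/
def ExpVal {M : Type*} [arithExp.Structure M] (x y z : M) : Prop :=
  Structure.RelMap expRel ![x, y, z]

/-- A substructure closed under `e`, on which `e` is total. -/
def ExpTotalOn {M : Type*} [arithExp.Structure M] (N : arithExp.Substructure M) : Prop :=
  ∀ x ∈ N, ∀ y ∈ N, ∃ z ∈ N, ExpVal x y z

/-- The ABC inequality with exponent `1 + 1/3` and constant `K` in the natural numbers. -/
def AbcNat (K : ℕ) : Prop :=
  ∀ a b c : ℕ, 0 < a → 0 < b → Nat.Coprime a b → a + b = c →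
    (c : ℝ) < K * ((UniqueFactorizationMonoid.radical (a * b * c) : ℕ) : ℝ) ^ (1 + 1 / 3 : ℝ)

/-- Catalan's conjecture in the natural numbers. -/
def CatalanNat : Prop :=
  ∀ a b m n : ℕ, 1 < a → 1 < b → 1 < m → 1 < n →
    (a ^ n = b ^ m + 1 ↔ a = 3 ∧ m = 3 ∧ b = 2 ∧ n = 2)

end WeakExp

namespace WeakExp

open FirstOrder FirstOrder.Language

/-! Let `e(a, n) = X`, `e(b, m) = Y` and `X = Y + 1` in a model. At standard exponents, both `e` and
the definable exponential are the ordinary power: for `e` by (e1), (e3) and (e4), for the definable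
one because the β-function codes every sequence of standard length (`powIn_natCast_iff`). So if `m`
and `n` are standard, Catalan's conjecture for `x ^ y` settles the matter.

If `n` is nonstandard, division by a standard `k` among the exponents gives `n = k q + j` with `j <
k` standard and `q ≠ 0`, hence `X = e(a, q) ^ k * a ^ j`. Every prime dividing `X` divides `e(a, q)
≥ 2`, so `rad(X) ^ k ≤ X` and `2 ^ k ≤ X` for every standard `k` (`ExpAxioms.smallRad`). The other
power satisfies at least `rad(Y) ^ 2 ≤ Y`. With `k = 8`, `rad(X Y) ≤ X ^ (5/8)`, and ABC for `Y + 1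
= X` yields `X < K ^ 6` (`lt_of_smallRad`), which contradicts `2 ^ k ≤ X` for large standard `k`.
The case of a nonstandard `m` is symmetric.

The argument needs radicals in models of `IΣ₁`; these come from the least number principle for
Δ₀-formulas (`exists_rad`). The nontrivial half of Catalan's conjecture is universal and the other
half is `3 ^ 2 = 2 ^ 3 + 1`, so it passes to substructures. Conversely, `ℕ` embeds in every model
and substructure, with `e` restricting to the true power. -/

/-- The operations and the order of `M` interpret the symbols of the language of arithmetic. -/
class ArithCompat (M : Type*) [Zero M] [One M] [Add M] [Mul M] [LE M] [arith.Structure M] :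
    Prop where
  funMap_zero (v : Fin 0 → M) : Structure.funMap zeroFunc v = 0
  funMap_one (v : Fin 0 → M) : Structure.funMap oneFunc v = 1
  funMap_add (v : Fin 2 → M) : Structure.funMap addFunc v = v 0 + v 1
  funMap_mul (v : Fin 2 → M) : Structure.funMap mulFunc v = v 0 * v 1
  relMap_le (v : Fin 2 → M) : Structure.RelMap leRel v ↔ v 0 ≤ v 1

instance : ArithCompat ℕ where
  funMap_zero _ := rfl
  funMap_one _ := rfl
  funMap_add _ := rfl
  funMap_mul _ := rfl
  relMap_le _ := Iff.rfl

/-! ### Interpretation of terms and of the induction axioms -/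

section RealizeContext

variable {M : Type*} [arith.Structure M] {α : Type} {n : ℕ}

@[simp] lemma realize_up (t : arith.Term (α ⊕ Fin n)) (v : α → M) (xs : Fin n → M) (x : M) :
    (up t).realize (Sum.elim v (Fin.snoc xs x : Fin (n + 1) → M)) =
      t.realize (Sum.elim v xs) := by
  rw [up, Term.realize_relabel]
  congr 1
  funext i
  rcases i with i | i <;> simp

@[simp] lemma realize_last (v : α → M) (xs : Fin n → M) (x : M) :
    (last n).realize (Sum.elim v (Fin.snoc xs x : Fin (n + 1) → M)) = x := by
  simp [last]

end RealizeContext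

section Realize

variable {M : Type*} [Zero M] [One M] [Add M] [Mul M] [LE M] [arith.Structure M] [ArithCompat M]
  {α : Type} {n : ℕ}

@[simp] lemma realize_zero (v : α → M) : (0 : arith.Term α).realize v = 0 :=
  ArithCompat.funMap_zero _

@[simp] lemma realize_one (v : α → M) : (1 : arith.Term α).realize v = 1 :=
  ArithCompat.funMap_one _

@[simp] lemma realize_add (t u : arith.Term α) (v : α → M) :
    (t + u).realize v = t.realize v + u.realize v :=
  (Term.realize_functions_apply₂ (f := addFunc)).trans (ArithCompat.funMap_add _)

@[simp] lemma realize_mul (t u : arith.Term α) (v : α → M) :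
    (t * u).realize v = t.realize v * u.realize v :=
  (Term.realize_functions_apply₂ (f := mulFunc)).trans (ArithCompat.funMap_mul _)

@[simp] lemma realize_le (t u : arith.Term (α ⊕ Fin n)) (v : α → M) (xs : Fin n → M) :
    (le t u).Realize v xs ↔ t.realize (Sum.elim v xs) ≤ u.realize (Sum.elim v xs) :=
  BoundedFormula.realize_rel₂.trans (ArithCompat.relMap_le _)

end Realize

lemma models_induction_iff {M : Type*} [arith.Structure M] [Zero M] [One M] [Add M] [Mul M] [LE M]
    [ArithCompat M] {k : ℕ} (φ : arith.Formula (Fin k ⊕ Unit)) :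
    M ⊨ induction φ ↔ ∀ v : Fin k → M, φ.Realize (Sum.elim v fun _ => 0) →
      (∀ x, φ.Realize (Sum.elim v fun _ => x) → φ.Realize (Sum.elim v fun _ => x + 1)) →
        ∀ x, φ.Realize (Sum.elim v fun _ => x) := by
  have key : ∀ (v : Fin k → M) (t : arith.Term (Fin k ⊕ Unit)) (i : Unit → M),
      (substVar φ t).Realize (Sum.elim v i) ↔
        φ.Realize (Sum.elim v fun _ => t.realize (Sum.elim v i)) := by
    intro v t i
    unfold substVar Formula.Realize
    rw [BoundedFormula.realize_subst]
    refine iff_of_eq (congrArg (fun w => BoundedFormula.Realize φ w default) ?_)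
    funext j
    rcases j with j | j <;> simp
  have hunit : ∀ p : (Unit → M) → Prop, (∀ i, p i) ↔ ∀ x, p fun _ => x :=
    fun p => ⟨fun h x => h _, fun h i => h (i ())⟩
  unfold induction Sentence.Realize
  rw [Formula.realize_iAlls]
  refine forall_congr' fun v => ?_
  rw [Formula.realize_relabel]
  simp only [Function.comp_def, Sum.elim_inr]
  rw [Formula.realize_imp, Formula.realize_inf, Formula.realize_iAlls, Formula.realize_iAlls,
    Formula.realize_iAlls]
  simp only [key, hunit, Formula.realize_imp]
  simp

lemma realize_of_mem {L : FirstOrder.Language} {M : Type*} [L.Structure M] {T : L.Theory}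
    (h : M ⊨ T) {σ : L.Sentence} (hσ : σ ∈ T) : M ⊨ σ :=
  T.model_iff.1 h σ hσ

/-! ### Models of `IΣ₁` are discretely ordered semirings -/

section Order0

variable {M : Type*} [arith.Structure M] [Zero M] [One M] [Add M] [Mul M] [LE M] [ArithCompat M]

lemma models_robinson_iff : M ⊨ robinson ↔
    ((0 : M) + 1 = 1 ∧ (∀ x : M, x + 1 ≠ 0) ∧ (∀ x y : M, x + 1 = y + 1 → x = y) ∧
    (∀ x : M, x ≠ 0 → ∃ y, x = y + 1) ∧ (∀ x : M, x + 0 = x) ∧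
    (∀ x y : M, x + (y + 1) = (x + y) + 1) ∧ (∀ x : M, x * 0 = 0) ∧
    (∀ x y : M, x * (y + 1) = x * y + x) ∧ ∀ x y : M, x ≤ y ↔ ∃ z, z + x = y) := by
  simp [robinson, Theory.model_iff, Sentence.Realize, Formula.Realize, Fin.snoc]

lemma delta0_induction (h : M ⊨ ISigma1) {k : ℕ} (φ : arith.Formula (Fin k ⊕ Unit))
    (hφ : IsDelta0 φ) (v : Fin k → M) (h0 : φ.Realize (Sum.elim v fun _ => 0))
    (h1 : ∀ x, φ.Realize (Sum.elim v fun _ => x) → φ.Realize (Sum.elim v fun _ => x + 1)) (x : M) :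
    φ.Realize (Sum.elim v fun _ => x) :=
  (models_induction_iff φ).1 (realize_of_mem h (Or.inr ⟨k, φ, .delta0 hφ, rfl⟩)) v h0 h1 x

/-- The `i`-th parameter of a formula with an induction variable. -/
abbrev par {k n : ℕ} (i : Fin k) : arith.Term ((Fin k ⊕ Unit) ⊕ Fin n) :=
  Term.var (Sum.inl (Sum.inl i))

/-- The induction variable. -/
abbrev ivar {k n : ℕ} : arith.Term ((Fin k ⊕ Unit) ⊕ Fin n) := Term.var (Sum.inl (Sum.inr ()))

/-- An equation of terms is Δ₀, so algebraic laws are open to induction; `f` and `g` are its two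
sides as functions of the induction variable. -/
lemma eq_induction (h : M ⊨ ISigma1) {k : ℕ} (t u : arith.Term ((Fin k ⊕ Unit) ⊕ Fin 0))
    (v : Fin k → M) (f g : M → M)
    (hf : ∀ x, t.realize (Sum.elim (Sum.elim v fun _ => x) default) = f x)
    (hg : ∀ x, u.realize (Sum.elim (Sum.elim v fun _ => x) default) = g x)
    (h0 : f 0 = g 0) (h1 : ∀ x, f x = g x → f (x + 1) = g (x + 1)) (x : M) : f x = g x := by
  have key : ∀ x, Formula.Realize (t =' u : arith.Formula (Fin k ⊕ Unit))
      (Sum.elim v fun _ => x) ↔ f x = g x := fun x => by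
    rw [Formula.Realize, BoundedFormula.realize_bdEqual, hf, hg]
  exact (key x).1 (delta0_induction h _ (.equal t u) v ((key 0).2 h0)
    (fun x hx => (key _).2 (h1 x ((key x).1 hx))) x)

end Order0

/-- Models of `IΣ₁`, as discretely ordered commutative semirings. -/
class ArithModel (M : Type*) [CommSemiring M] [LinearOrder M] [arith.Structure M] : Prop extends
    IsStrictOrderedRing M, CanonicallyOrderedAdd M, ArithCompat M where
  lt_one (x : M) : x < 1 → x = 0
  models : M ⊨ ISigma1

/-- The semiring laws are equations, and cancellation and totality of the order are quantifier-free,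
so each follows by induction on one variable with the others as parameters. The order is `∃ z, z + x
= y`, which reduces its remaining properties to those of addition. -/
theorem exists_arithModel {M : Type*} [arith.Structure M] [iz : Zero M] [io : One M] [ia : Add M]
    [im : Mul M] [il : LE M] [ArithCompat M] (h : M ⊨ ISigma1) :
    ∃ (_ : CommSemiring M) (_ : LinearOrder M), ArithModel M := by
  obtain ⟨h01, hne, hinj, hpred, hadd0, hadds, hmul0, hmuls, hle⟩ :=
    (models_robinson_iff (M := M)).1 (h.mono Set.subset_union_left)
  have zero_add' : ∀ x : M, 0 + x = x := by
    refine eq_induction h (k := 0) (0 + ivar) ivar ![] (fun x => 0 + x) (fun x => x)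
      (by simp) (by simp) (hadd0 0) fun x hx => ?_
    rw [hadds, hx]
  have add_assoc' : ∀ x y z : M, (x + y) + z = x + (y + z) := by
    intro x y
    refine eq_induction h (k := 2) ((par 0 + par 1) + ivar) (par 0 + (par 1 + ivar)) ![x, y]
      (fun z => (x + y) + z) (fun z => x + (y + z)) (by simp) (by simp)
      (by simp only [hadd0]) fun z hz => ?_
    rw [hadds, hz, hadds, hadds]
  have one_add' : ∀ x : M, 1 + x = x + 1 := by
    refine eq_induction h (k := 0) (1 + ivar) (ivar + 1) ![] (fun x => 1 + x) (fun x => x + 1)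
      (by simp) (by simp) (by simp only [hadd0, h01]) fun x hx => ?_
    rw [hadds, hx]
  have add_comm' : ∀ x y : M, x + y = y + x := by
    intro x
    refine eq_induction h (k := 1) (par 0 + ivar) (ivar + par 0) ![x] (fun y => x + y)
      (fun y => y + x) (by simp) (by simp) (by simp only [hadd0, zero_add']) fun y hy => ?_
    rw [hadds, hy, add_assoc' y 1, one_add', hadds]
  have zero_mul' : ∀ x : M, 0 * x = 0 := by
    refine eq_induction h (k := 0) (0 * ivar) 0 ![] (fun x => 0 * x) (fun _ => 0)
      (by simp) (by simp) (hmul0 0) fun x hx => ?_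
    rw [hmuls, hx, hadd0]
  have succ_mul' : ∀ y x : M, (y + 1) * x = y * x + x := by
    intro y
    refine eq_induction h (k := 1) ((par 0 + 1) * ivar) (par 0 * ivar + ivar) ![y]
      (fun x => (y + 1) * x) (fun x => y * x + x) (by simp) (by simp)
      (by simp only [hmul0, hadd0]) fun x hx => ?_
    rw [hmuls, hx, hmuls, hadds, hadds, add_assoc' (y * x) x y, add_assoc' (y * x) y x, add_comm' x y]
  have mul_comm' : ∀ x y : M, x * y = y * x := by
    intro x
    refine eq_induction h (k := 1) (par 0 * ivar) (ivar * par 0) ![x] (fun y => x * y)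
      (fun y => y * x) (by simp) (by simp) (by simp only [hmul0, zero_mul']) fun y hy => ?_
    rw [hmuls, hy, succ_mul']
  have mul_add' : ∀ x y z : M, x * (y + z) = x * y + x * z := by
    intro x y
    refine eq_induction h (k := 2) (par 0 * (par 1 + ivar)) (par 0 * par 1 + par 0 * ivar) ![x, y]
      (fun z => x * (y + z)) (fun z => x * y + x * z) (by simp) (by simp)
      (by simp only [hadd0, hmul0]) fun z hz => ?_
    rw [hadds, hmuls, hz, hmuls, add_assoc']
  have mul_assoc' : ∀ x y z : M, (x * y) * z = x * (y * z) := by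
    intro x y
    refine eq_induction h (k := 2) ((par 0 * par 1) * ivar) (par 0 * (par 1 * ivar)) ![x, y]
      (fun z => (x * y) * z) (fun z => x * (y * z)) (by simp) (by simp)
      (by simp only [hmul0]) fun z hz => ?_
    rw [hmuls, hz, hmuls, mul_add']
  have mul_one' : ∀ x : M, x * 1 = x := fun x => by rw [← h01, hmuls, hmul0, zero_add']
  have add_cancel : ∀ x y z : M, x + z = y + z → x = y := by
    intro x y z
    let φ : arith.Formula (Fin 2 ⊕ Unit) :=
      ((par 0 + ivar) =' (par 1 + ivar)) ⟹ (par 0 =' par 1)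
    have key : ∀ z, φ.Realize (Sum.elim ![x, y] fun _ => z) ↔ (x + z = y + z → x = y) := by
      intro z; simp [φ, Formula.Realize]
    refine (key z).1 (delta0_induction h φ (.imp (.equal _ _) (.equal _ _)) _ ?_ ?_ z)
    · simp [key, hadd0]
    · intro z; rw [key, key, hadds, hadds]; exact fun h1 h2 => h1 (hinj _ _ h2)
  have le_total' : ∀ x y : M, x ≤ y ∨ y ≤ x := by
    intro x y
    -- The disjunction `x ≤ y ∨ y ≤ x`, spelled with implication and falsum to fit the clauses of
    -- `IsDelta0`.
    let φ : arith.Formula (Fin 1 ⊕ Unit) :=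
      ((le (par 0) ivar) ⟹ BoundedFormula.falsum) ⟹ (le ivar (par 0))
    have key : ∀ x, φ.Realize (Sum.elim ![y] fun _ => x) ↔ x ≤ y ∨ y ≤ x := by
      intro x
      have : φ.Realize (Sum.elim ![y] fun _ => x) ↔ (¬ y ≤ x → x ≤ y) := by
        simp [φ, Formula.Realize, BoundedFormula.Realize]
      rw [this]; tauto
    refine (key x).1 (delta0_induction h φ (.imp (.imp (.le _ _) .falsum) (.le _ _)) _ ?_ ?_ x)
    · rw [key]; exact Or.inl ((hle _ _).2 ⟨y, hadd0 y⟩)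
    · intro x; rw [key, key]
      rintro (hx | hx)
      · obtain ⟨z, hz⟩ := (hle _ _).1 hx
        by_cases hz0 : z = 0
        · refine Or.inr ((hle _ _).2 ⟨1, ?_⟩)
          rw [← hz, hz0, zero_add', add_comm']
        · obtain ⟨w, rfl⟩ := hpred z hz0
          refine Or.inl ((hle _ _).2 ⟨w, ?_⟩)
          rw [← hz, add_assoc', one_add']
      · obtain ⟨z, hz⟩ := (hle _ _).1 hx
        refine Or.inr ((hle _ _).2 ⟨z + 1, ?_⟩)
        rw [← hz, add_assoc', one_add', hadds]
  have add_eq_zero' : ∀ x y : M, x + y = 0 → y = 0 := by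
    intro x y hxy
    by_contra hy
    obtain ⟨w, rfl⟩ := hpred y hy
    rw [hadds] at hxy
    exact hne _ hxy
  classical
  let cs : CommSemiring M :=
    { iz, io, ia, im with
      add_assoc := add_assoc', zero_add := zero_add', add_zero := hadd0, add_comm := add_comm'
      nsmul := nsmulRec
      mul_assoc := mul_assoc', mul_comm := mul_comm', mul_one := mul_one'
      one_mul := fun x => by rw [mul_comm', mul_one']
      zero_mul := zero_mul', mul_zero := hmul0, left_distrib := mul_add'
      right_distrib := fun x y z => by rw [mul_comm', mul_add', mul_comm' z, mul_comm' z] }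
  let lo : LinearOrder M :=
    { il with
      le_refl := fun x => (hle _ _).2 ⟨0, zero_add' x⟩
      le_trans := fun x y z hxy hyz => by
        obtain ⟨u, rfl⟩ := (hle _ _).1 hxy
        obtain ⟨w, rfl⟩ := (hle _ _).1 hyz
        exact (hle _ _).2 ⟨w + u, add_assoc' _ _ _⟩
      le_antisymm := fun x y hxy hyx => by
        obtain ⟨u, rfl⟩ := (hle _ _).1 hxy
        obtain ⟨w, hw⟩ := (hle _ _).1 hyx
        have : (w + u) + x = 0 + x := by rw [add_assoc', hw, zero_add']
        rw [add_eq_zero' _ _ (add_cancel _ _ _ this), zero_add']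
      le_total := le_total'
      toDecidableLE := Classical.decRel _ }
  have pos_iff : ∀ x : M, 0 < x ↔ x ≠ 0 := fun x =>
    ⟨fun hx => hx.ne', fun hx => lt_of_le_of_ne ((hle _ _).2 ⟨x, hadd0 x⟩) hx.symm⟩
  have hcan : CanonicallyOrderedAdd M :=
    { exists_add_of_le := fun {x y} hxy => by
        obtain ⟨u, rfl⟩ := (hle _ _).1 hxy
        exact ⟨u, add_comm' _ _⟩
      le_add_self := fun x y => (hle _ _).2 ⟨y, rfl⟩
      le_self_add := fun x y => (hle _ _).2 ⟨y, add_comm' _ _⟩ }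
  have hcancel : IsOrderedCancelAddMonoid M :=
    { add_le_add_left := fun x y hxy z => by
        obtain ⟨u, rfl⟩ := (hle _ _).1 hxy
        exact (hle _ _).2 ⟨u, (add_assoc' _ _ _).symm⟩
      le_of_add_le_add_left := fun x y z hyz => by
        obtain ⟨u, hu⟩ := (hle _ _).1 hyz
        refine (hle _ _).2 ⟨u, add_cancel _ _ x ?_⟩
        rw [add_assoc', add_comm' y, hu, add_comm'] }
  have hpos : PosMulStrictMono M :=
    ⟨fun x hx y z hyz => by
      obtain ⟨u, rfl⟩ := (hle _ _).1 hyz.le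
      have hu : u ≠ 0 := by
        rintro rfl
        exact hyz.ne (zero_add' y).symm
      obtain ⟨w, rfl⟩ := hpred u hu
      obtain ⟨x', rfl⟩ := hpred x hx.ne'
      have hs : (x' + 1) * (w + 1) ≠ 0 := by
        rw [hmuls, hadds]; exact hne _
      have := add_lt_add_of_lt_of_le ((pos_iff _).2 hs) (le_refl ((x' + 1) * y))
      rw [mul_add']
      rwa [zero_add'] at this⟩
  have h10 : (1 : M) ≠ 0 := fun h1 => hne 0 (by rw [h01, h1])
  have hnt : Nontrivial M := ⟨⟨1, 0, h10⟩⟩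
  have hzo : ZeroLEOneClass M := ⟨((pos_iff 1).2 h10).le⟩
  have hmp : MulPosStrictMono M :=
    ⟨fun x hx y z hyz => by
      rw [mul_comm' y, mul_comm' z]; exact mul_lt_mul_of_pos_left hyz hx⟩
  have hso : IsStrictOrderedRing M := { hcancel, hzo, hnt, hpos, hmp with }
  refine ⟨cs, lo, { hso, hcan with
    funMap_zero := ArithCompat.funMap_zero
    funMap_one := ArithCompat.funMap_one
    funMap_add := ArithCompat.funMap_add
    funMap_mul := ArithCompat.funMap_mul
    relMap_le := ArithCompat.relMap_le
    lt_one := fun x hx => ?_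
    models := h }⟩
  by_contra hx0
  obtain ⟨y, rfl⟩ := hpred x hx0
  exact absurd hx (not_lt.2 ((hle _ _).2 ⟨y, rfl⟩))

/-! ### Divisibility, primes and radicals in a model -/

/-- Primes, as defined in the language of arithmetic. -/
def PrimeIn {M : Type*} [CommSemiring M] [LinearOrder M] (p : M) : Prop :=
  1 < p ∧ ∀ d, d ∣ p → d = 1 ∨ d = p

lemma PrimeIn.eq_of_dvd {M : Type*} [CommSemiring M] [LinearOrder M] {p q : M} (hp : PrimeIn p)
    (hq : PrimeIn q) (h : p ∣ q) : p = q :=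
  (hq.2 p h).resolve_left hp.1.ne'

/-- Radicals, as defined in the language of arithmetic. -/
def RadIn {M : Type*} [CommSemiring M] [LinearOrder M] (r x : M) : Prop :=
  (∀ t, t * t ∣ r → t = 1) ∧ ∀ p, PrimeIn p → (p ∣ r ↔ p ∣ x)

section RealizeRing

variable {M : Type*} [CommSemiring M] [LinearOrder M] [arith.Structure M] [ArithCompat M]
  {α : Type} {n : ℕ}

@[simp] lemma realize_nmul (k : ℕ) (t : arith.Term α) (v : α → M) :
    (nmul k t).realize v = k * t.realize v := by
  induction k with
  | zero => simp [nmul]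
  | succ k ih => simp [nmul, ih, add_mul]

@[simp] lemma realize_num (k : ℕ) (v : α → M) : (num k : arith.Term α).realize v = k := by
  simp [num]

@[simp] lemma realize_npow (k : ℕ) (t : arith.Term α) (v : α → M) :
    (npow t k).realize v = t.realize v ^ k := by
  induction k with
  | zero => simp [npow]
  | succ k ih => simp [npow, ih, pow_succ]

variable (t u w : arith.Term (α ⊕ Fin n)) (v : α → M) (xs : Fin n → M)

@[simp] lemma realize_lt :
    (lt t u).Realize v xs ↔ t.realize (Sum.elim v xs) < u.realize (Sum.elim v xs) := by
  simp [lt, lt_iff_le_and_ne]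

@[simp] lemma realize_dvd :
    (dvd t u).Realize v xs ↔ t.realize (Sum.elim v xs) ∣ u.realize (Sum.elim v xs) := by
  simp [dvd, Dvd.dvd, eq_comm]

@[simp] lemma realize_prime : (prime t).Realize v xs ↔ PrimeIn (t.realize (Sum.elim v xs)) := by
  simp [prime, PrimeIn]

@[simp] lemma realize_isRad :
    (isRad t u).Realize v xs ↔ RadIn (t.realize (Sum.elim v xs)) (u.realize (Sum.elim v xs)) := by
  simp [isRad, RadIn]

@[simp] lemma realize_coprime : (coprime t u w).Realize v xs ↔
    ∀ d : M, d ∣ t.realize (Sum.elim v xs) → d ∣ u.realize (Sum.elim v xs) →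
      d ∣ w.realize (Sum.elim v xs) → d = 1 := by
  simp [coprime]

lemma realize_abc_iff (K : ℕ) : M ⊨ abc K ↔ ∀ a b c r : M, 0 < a → 0 < b → 0 < c →
    (∀ d : M, d ∣ a → d ∣ b → d ∣ c → d = 1) → a + b = c → RadIn r (a * b * c) →
      c ^ 3 < (K : M) ^ 3 * r ^ 4 := by
  simp [abc, Sentence.Realize, Formula.Realize, Fin.snoc]

end RealizeRing

/-! ### Δ₀ versions of divisibility and primality -/

section BoundedFormulas

variable {α : Type} {n : ℕ}

lemma IsDelta0.inf {φ ψ : arith.BoundedFormula α n} (hφ : IsDelta0 φ) (hψ : IsDelta0 ψ) :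
    IsDelta0 (φ ⊓ ψ) :=
  .imp (.imp hφ (.imp hψ .falsum)) .falsum

lemma IsDelta0.not {φ : arith.BoundedFormula α n} (hφ : IsDelta0 φ) : IsDelta0 (∼φ) :=
  .imp hφ .falsum

lemma IsDelta0.lt (t u : arith.Term (α ⊕ Fin n)) : IsDelta0 (WeakExp.lt t u) :=
  (IsDelta0.le t u).inf (IsDelta0.equal t u).not

/-- Divisibility, with a bounded quantifier. -/
def bdvd (t u : arith.Term (α ⊕ Fin n)) : arith.BoundedFormula α n :=
  ∃' (le (last n) (up u) ⊓ ((up t * last n) =' up u))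

/-- Primality, with bounded quantifiers. -/
def bprime (p : arith.Term (α ⊕ Fin n)) : arith.BoundedFormula α n :=
  lt 1 p ⊓ ∀' (le (last n) (up p) ⟹
    (bdvd (last n) (up p) ⟹ (∼(last n =' 1) ⟹ (last n =' up p))))

lemma isDelta0_bdvd (t u : arith.Term (α ⊕ Fin n)) : IsDelta0 (bdvd t u) :=
  .bex u (.equal _ _)

lemma isDelta0_bprime (p : arith.Term (α ⊕ Fin n)) : IsDelta0 (bprime p) :=
  (IsDelta0.lt _ _).inf
    (.ball p (.imp (isDelta0_bdvd _ _) (.imp (IsDelta0.equal _ _).not (.equal _ _))))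

end BoundedFormulas

/-! ### Least number principle, Euclid's lemma, existence of radicals -/

section Models

variable {M : Type*} [CommSemiring M] [LinearOrder M] [arith.Structure M] [ArithModel M]

lemma lt_add_one_iff' {x y : M} : x < y + 1 ↔ x ≤ y := by
  refine ⟨fun h => ?_, fun h => lt_of_le_of_lt h (lt_add_one y)⟩
  by_contra hyx
  obtain ⟨c, rfl⟩ := exists_add_of_le (not_le.1 hyx).le
  have : c = 0 := ArithModel.lt_one c (lt_of_add_lt_add_left h)
  simp [this] at hyx

lemma add_one_le_iff' {x y : M} : x + 1 ≤ y ↔ x < y := by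
  rw [← not_lt, lt_add_one_iff', not_le]

lemma exists_eq_add_one {x : M} (hx : x ≠ 0) : ∃ y, x = y + 1 := by
  obtain ⟨c, hc⟩ := exists_add_of_le (add_one_le_iff'.2 (pos_iff_ne_zero.2 hx))
  exact ⟨c, by rw [hc]; ring⟩

lemma le_of_dvd' {x y : M} (hy : y ≠ 0) (h : x ∣ y) : x ≤ y := by
  obtain ⟨c, rfl⟩ := h
  have hc : 1 ≤ c := by
    obtain ⟨d, rfl⟩ := exists_eq_add_one (x := c) (by rintro rfl; simp at hy)
    exact le_add_self
  simpa using mul_le_mul_of_nonneg_left hc (zero_le (a := x))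

@[simp] lemma realize_bdvd {α : Type} {n : ℕ} (t u : arith.Term (α ⊕ Fin n)) (v : α → M)
    (xs : Fin n → M) :
    (bdvd t u).Realize v xs ↔ t.realize (Sum.elim v xs) ∣ u.realize (Sum.elim v xs) := by
  simp only [bdvd, BoundedFormula.realize_ex, BoundedFormula.realize_inf, realize_le, realize_last,
    realize_up, BoundedFormula.realize_bdEqual, realize_mul]
  refine ⟨fun ⟨c, _, hc⟩ => ⟨c, hc.symm⟩, fun h => ?_⟩
  by_cases hu : u.realize (Sum.elim v xs) = 0
  · exact ⟨0, by simp, by simp [hu]⟩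
  · obtain ⟨c, hc⟩ := h
    exact ⟨c, le_of_dvd' hu ⟨_, by rw [hc, mul_comm]⟩, hc.symm⟩

@[simp] lemma realize_bprime {α : Type} {n : ℕ} (t : arith.Term (α ⊕ Fin n)) (v : α → M)
    (xs : Fin n → M) : (bprime t).Realize v xs ↔ PrimeIn (t.realize (Sum.elim v xs)) := by
  simp only [bprime, PrimeIn, BoundedFormula.realize_all, BoundedFormula.realize_inf, realize_le,
    realize_last, realize_up, BoundedFormula.realize_bdEqual, realize_lt, realize_bdvd,
    BoundedFormula.realize_imp, BoundedFormula.realize_not, realize_one]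
  refine and_congr_right fun h => ⟨fun H d hd => ?_, fun H d _ hd hd1 => (H d hd).resolve_left hd1⟩
  exact or_iff_not_imp_left.2 (H d (le_of_dvd' (zero_lt_one.trans h).ne' hd) hd)

/-- The least number principle for formulas with bounded quantifiers. -/
lemma exists_least {k : ℕ} (φ : arith.BoundedFormula (Fin k ⊕ Unit) 1) (hφ : IsDelta0 φ)
    (v : Fin k → M) (P : M → Prop)
    (hP : ∀ x y, φ.Realize (Sum.elim v fun _ => x) (Fin.snoc default y : Fin 1 → M) ↔ P y)
    (h : ∃ y, P y) : ∃ y, P y ∧ ∀ z < y, ¬ P z := by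
  by_contra! hcon
  -- Induction on `x` for "no `y ≤ x` satisfies `P`". By `hP`, `φ` does not depend on the induction
  -- variable, which serves only as the bound here.
  let ψ : arith.Formula (Fin k ⊕ Unit) :=
    ∀' (le (last 0) (up ivar) ⟹ (φ ⟹ BoundedFormula.falsum))
  have key : ∀ x, ψ.Realize (Sum.elim v fun _ => x) ↔ ∀ y ≤ x, ¬ P y := by
    intro x
    simp [ψ, Formula.Realize, hP, BoundedFormula.Realize]
  have hψ : ∀ x, ψ.Realize (Sum.elim v fun _ => x) := by
    refine delta0_induction ArithModel.models ψ (.ball ivar (.imp hφ .falsum)) v ?_ ?_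
    · rw [key]
      intro y hy hPy
      obtain ⟨z, hz, _⟩ := hcon y hPy
      exact not_lt_zero (hz.trans_le hy)
    · intro x hx
      rw [key] at hx ⊢
      intro y hy hPy
      obtain ⟨z, hz, hPz⟩ := hcon y hPy
      exact hx z (lt_add_one_iff'.1 (hz.trans_le hy)) hPz
  obtain ⟨y, hy⟩ := h
  exact (key y).1 (hψ y) y le_rfl hy

/-- The quotient is the least `q` with `x < (q + 1) * d`; since `d ≥ 1`, such `q` exist, for example
`x`. -/
lemma exists_div_mod (x : M) {d : M} (hd : d ≠ 0) : ∃ q r, x = q * d + r ∧ r < d := by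
  have hd1 : 1 ≤ d := by simpa using add_one_le_iff'.2 (pos_iff_ne_zero.2 hd)
  obtain ⟨q, hq, hmin⟩ := exists_least (k := 2) (lt (up (par 0)) ((last 0 + 1) * up (par 1)))
    (IsDelta0.lt _ _) ![x, d] (fun q => x < (q + 1) * d) (by intros; simp)
    ⟨x, (lt_add_one x).trans_le (le_mul_of_one_le_right zero_le hd1)⟩
  have hqx : q * d ≤ x := by
    by_cases hq0 : q = 0
    · simp [hq0]
    · obtain ⟨q', rfl⟩ := exists_eq_add_one hq0
      exact not_lt.1 (hmin q' (lt_add_one q'))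
  obtain ⟨r, rfl⟩ := exists_add_of_le hqx
  refine ⟨q, r, rfl, ?_⟩
  rw [add_mul, one_mul] at hq
  exact lt_of_add_lt_add_left hq

/-- In place of subtraction: if `x = p a` and `x + y = p b` with `p ≠ 0`, then `a ≤ b`, so `b = a +
c` and `y = p c` by cancellation. -/
lemma dvd_of_dvd_add {p x y : M} (h : p ∣ x + y) (hx : p ∣ x) : p ∣ y := by
  by_cases hp : p = 0
  · subst hp
    rw [zero_dvd_iff] at *
    simpa [hx] using h
  obtain ⟨a, rfl⟩ := hx
  obtain ⟨b, hb⟩ := h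
  have hab : a ≤ b := le_of_mul_le_mul_left (by rw [← hb]; exact le_self_add)
    (pos_iff_ne_zero.2 hp)
  obtain ⟨c, rfl⟩ := exists_add_of_le hab
  exact ⟨c, by rw [mul_add] at hb; exact add_left_cancel hb⟩

lemma PrimeIn.ne_zero {p : M} (hp : PrimeIn p) : p ≠ 0 := (zero_lt_one.trans hp.1).ne'

/-- Let `t` be the least nonzero number with `p ∣ t * a`. By division with remainder, `t` divides
every `s` with `p ∣ s * a`, in particular `p` and `b`. So `t = 1` and `p ∣ a`, or `t = p` and `p ∣
b`. -/
lemma PrimeIn.dvd_or_dvd {p a b : M} (hp : PrimeIn p) (h : p ∣ a * b) : p ∣ a ∨ p ∣ b := by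
  obtain ⟨t, ⟨ht0, hta⟩, hmin⟩ := exists_least (k := 2)
    (∼(last 0 =' 0) ⊓ bdvd (up (par 0)) (last 0 * up (par 1)))
    ((IsDelta0.equal _ _).not.inf (isDelta0_bdvd _ _)) ![p, a] (fun t => t ≠ 0 ∧ p ∣ t * a)
    (by intros; simp) ⟨p, hp.ne_zero, dvd_mul_right _ _⟩
  have hdvd : ∀ s, p ∣ s * a → t ∣ s := by
    intro s hs
    obtain ⟨q, r, rfl, hr⟩ := exists_div_mod s ht0
    have : p ∣ r * a := by
      rw [add_mul, mul_assoc] at hs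
      exact dvd_of_dvd_add hs (hta.mul_left q)
    by_cases hr0 : r = 0
    · simp [hr0]
    · exact absurd ⟨hr0, this⟩ (hmin r hr)
  rcases hp.2 t (hdvd p (dvd_mul_right _ _)) with rfl | rfl
  · left; simpa using hta
  · right; exact hdvd b (by rwa [mul_comm])

/-- Every nonzero `x` has a radical, which is bounded by all nonzero numbers with the same
prime divisors. -/
theorem exists_rad {x : M} (hx : x ≠ 0) :
    ∃ r, RadIn r x ∧ ∀ y, y ≠ 0 → (∀ p, PrimeIn p → p ∣ x → p ∣ y) → r ≤ y := by
  -- Prime divisors of `x` are at most `x`, so the condition on `y` is Δ₀.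
  have key : ∀ y : M, (∀ p, PrimeIn p → p ∣ x → p ∣ y) ↔
      ∀ p ≤ x, PrimeIn p → p ∣ x → p ∣ y :=
    fun y => ⟨fun h p _ => h p, fun h p hp hpx => h p (le_of_dvd' hx hpx) hp hpx⟩
  -- The least nonzero `r` divisible by all primes of `x`. A square factor `t * t` or a prime factor
  -- foreign to `x` could be reduced, leaving a smaller such number.
  obtain ⟨r, ⟨hr0, hr⟩, hmin⟩ := exists_least (k := 1)
    (∼(last 0 =' 0) ⊓ ∀' (le (last 1) (up (par 0)) ⟹ (bprime (last 1) ⟹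
      (bdvd (last 1) (par 0) ⟹ bdvd (last 1) (up (last 0))))))
    ((IsDelta0.equal _ _).not.inf (.ball (par 0) (.imp (isDelta0_bprime _)
      (.imp (isDelta0_bdvd _ _) (isDelta0_bdvd _ _))))) ![x]
    (fun y => y ≠ 0 ∧ ∀ p, PrimeIn p → p ∣ x → p ∣ y)
    (by intros; simp [key]) ⟨x, hx, fun _ _ h => h⟩
  have hlt : ∀ s t : M, s * t = r → t ≠ 1 → s < r ∧ s ≠ 0 := by
    rintro s t rfl ht
    have hs0 : s ≠ 0 := left_ne_zero_of_mul hr0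
    refine ⟨lt_of_le_of_ne (le_of_dvd' hr0 (dvd_mul_right _ _)) fun h => ht ?_, hs0⟩
    exact mul_left_cancel₀ hs0 (by rw [← h, mul_one])
  refine ⟨r, ⟨fun t ht => ?_, fun p hp => ⟨fun hpr => ?_, hr p hp⟩⟩, fun y hy0 hy => ?_⟩
  · obtain ⟨c, hc⟩ := ht
    by_contra ht1
    obtain ⟨h1, h2⟩ := hlt (t * c) t (by rw [hc]; ring) ht1
    refine hmin _ h1 ⟨h2, fun p hp hpx => ?_⟩
    have := hr p hp hpx
    rw [hc, mul_assoc] at this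
    rcases hp.dvd_or_dvd this with h | h
    · exact h.mul_right c
    · exact h
  · obtain ⟨c, hc⟩ := hpr
    by_contra hpx
    obtain ⟨h1, h2⟩ := hlt c p (by rw [hc]; ring) hp.1.ne'
    refine hmin _ h1 ⟨h2, fun q hq hqx => ?_⟩
    have := hr q hq hqx
    rw [hc] at this
    refine (hq.dvd_or_dvd this).resolve_left fun h => hpx ?_
    rwa [← hq.eq_of_dvd hp h]
  · by_contra hlt
    exact hmin y (not_le.1 hlt) ⟨hy0, hy⟩

end Models

/-! ### The β-function and the definable exponential -/

/-- Gödel's β-function. -/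
def BetaIn {M : Type*} [CommSemiring M] [LinearOrder M] (c d i u : M) : Prop :=
  u < 1 + (i + 1) * d ∧ ∃ q, c = q * (1 + (i + 1) * d) + u

/-- The graph of the definable exponential. -/
def PowIn {M : Type*} [CommSemiring M] [LinearOrder M] (x y z : M) : Prop :=
  ∃ c d : M, BetaIn c d 0 1 ∧ BetaIn c d y z ∧
    ∀ i < y, ∃ s, BetaIn c d i s ∧ BetaIn c d (i + 1) (s * x)

/-- Catalan's conjecture for an exponential with graph `G`. -/
def CatalanFor {M : Type*} [CommSemiring M] [LinearOrder M] (G : M → M → M → Prop) : Prop :=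
  ∀ a b m n : M, 1 < a → 1 < b → 1 < m → 1 < n →
    ((∃ u v, G a n u ∧ G b m v ∧ u = v + 1) ↔ a = 3 ∧ m = 3 ∧ b = 2 ∧ n = 2)

section RealizePow

variable {M : Type*} [CommSemiring M] [LinearOrder M] [arith.Structure M] [ArithCompat M]
  {α : Type} {n : ℕ} (t u w z : arith.Term (α ⊕ Fin n)) (v : α → M) (xs : Fin n → M)

@[simp] lemma realize_beta : (beta t u w z).Realize v xs ↔
    BetaIn (t.realize (Sum.elim v xs)) (u.realize (Sum.elim v xs)) (w.realize (Sum.elim v xs))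
      (z.realize (Sum.elim v xs)) := by
  simp [beta, BetaIn]

@[simp] lemma realize_expGraph : (expGraph t u w).Realize v xs ↔
    PowIn (t.realize (Sum.elim v xs)) (u.realize (Sum.elim v xs))
      (w.realize (Sum.elim v xs)) := by
  simp [expGraph, PowIn, and_assoc]

lemma realize_catalan {L' : FirstOrder.Language.{0, 0}} (ι : arith →ᴸ L') [L'.Structure M]
    [ι.IsExpansionOn M] (G : (t u v : arith.Term (Empty ⊕ Fin 6)) → L'.BoundedFormula Empty 6)
    (G' : M → M → M → Prop)
    (hG : ∀ t u w v xs, (G t u w).Realize v xs ↔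
      G' (t.realize (Sum.elim v xs)) (u.realize (Sum.elim v xs)) (w.realize (Sum.elim v xs))) :
    M ⊨ catalan ι G ↔ CatalanFor G' := by
  simp [catalan, CatalanFor, Sentence.Realize, Formula.Realize, hG, Fin.snoc, and_assoc]

lemma models_catalanDef_iff : M ⊨ catalanDef ↔ CatalanFor (PowIn (M := M)) :=
  realize_catalan (LHom.id arith) expGraph _ fun _ _ _ _ _ => realize_expGraph _ _ _ _ _

end RealizePow

section Models

variable {M : Type*} [CommSemiring M] [LinearOrder M] [arith.Structure M] [ArithModel M]

lemma BetaIn.unique {c d i u w : M} (hu : BetaIn c d i u) (hw : BetaIn c d i w) : u = w := by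
  obtain ⟨hu, q, rfl⟩ := hu
  obtain ⟨hw, q', h⟩ := hw
  generalize 1 + (i + 1) * d = m at *
  have aux : ∀ {q q' u w : M}, u < m → q * m + u = q' * m + w → ¬ q < q' := by
    intro q q' u w hu h hq
    obtain ⟨r, rfl⟩ := exists_add_of_le (add_one_le_iff'.2 hq)
    have : u = (1 + r) * m + w := by
      refine add_left_cancel (a := q * m) ?_
      rw [h]; ring
    rw [this, add_mul, one_mul, add_assoc] at hu
    exact absurd le_self_add (not_le.2 hu)
  obtain rfl : q = q' :=
    le_antisymm (not_lt.1 (aux hw h.symm)) (not_lt.1 (aux hu h))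
  exact add_left_cancel h

/-- `a` has an inverse modulo `m`. -/
def InvMod {M : Type*} [CommSemiring M] (a m : M) : Prop := ∃ u w : M, u * a = w * m + 1

lemma InvMod.mul {M : Type*} [CommSemiring M] {a b m : M} (ha : InvMod a m) (hb : InvMod b m) :
    InvMod (a * b) m := by
  obtain ⟨u, w, h⟩ := ha
  obtain ⟨u', w', h'⟩ := hb
  refine ⟨u * u', w * w' * m + w + w', ?_⟩
  calc u * u' * (a * b) = (u * a) * (u' * b) := by ring
    _ = _ := by rw [h, h']; ring

lemma InvMod.prod {M : Type*} [CommSemiring M] (f : ℕ → M) {m : M} (k : ℕ)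
    (h : ∀ i < k, InvMod (f i) m) : InvMod (∏ i ∈ Finset.range k, f i) m := by
  induction k with
  | zero => exact ⟨1, 0, by simp⟩
  | succ k ih =>
    rw [Finset.prod_range_succ]
    exact (ih fun i hi => h i (by omega)).mul (h k (by omega))

/-- The Chinese remainder theorem for a standard number of moduli, by external induction. A solution
`c` for the first `k` moduli is corrected by a multiple of their product, which is invertible modulo
`f k`. With `r` the remainder of `c`, the complement `r'` with `f k = r + r'` plays the role of
`-c`. -/
lemma exists_chinese (f s : ℕ → M) (hf : ∀ i, f i ≠ 0) (k : ℕ)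
    (h : ∀ i j, i < j → j < k → InvMod (f i) (f j)) :
    ∃ c, ∀ i < k, ∃ q, c = q * f i + s i := by
  induction k with
  | zero => exact ⟨0, by simp⟩
  | succ k ih =>
    obtain ⟨c, hc⟩ := ih fun i j hij hj => h i j hij (by omega)
    obtain ⟨u, w, huw⟩ := InvMod.prod f k fun i hi => h i k hi (by omega)
    obtain ⟨q, r, hqr, hr⟩ := exists_div_mod c (hf k)
    obtain ⟨r', hr'⟩ := exists_add_of_le hr.le
    refine ⟨c + u * (r' + s k) * ∏ i ∈ Finset.range k, f i, fun i hi => ?_⟩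
    rcases Nat.lt_succ_iff_lt_or_eq.1 hi with hi | rfl
    · obtain ⟨q', hq'⟩ := hc i hi
      obtain ⟨g, hg⟩ := Finset.dvd_prod_of_mem f (Finset.mem_range.2 hi)
      refine ⟨q' + u * (r' + s k) * g, ?_⟩
      rw [hg, hq']; ring
    · refine ⟨q + 1 + (r' + s i) * w, ?_⟩
      calc c + u * (r' + s i) * ∏ j ∈ Finset.range i, f j
          = c + (r' + s i) * (u * ∏ j ∈ Finset.range i, f j) := by ring
        _ = q * f i + (r + r') + s i + (r' + s i) * w * f i := by rw [huw, hqr]; ring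
        _ = _ := by rw [← hr']; ring

/-- Sequences of standard length are coded by the β-function. -/
lemma exists_beta (s : ℕ → M) (n : ℕ) : ∃ c d : M, ∀ i ≤ n, BetaIn c d (i : M) (s i) := by
  obtain ⟨d, hd0, hdvd, hlt⟩ : ∃ d : M, d ≠ 0 ∧ (∀ j : ℕ, j < n → ((j : M) + 1) ∣ d) ∧
      ∀ i ≤ n, s i ≤ d := by
    have h1 : (1 : M) ≤ (n.factorial : M) := by exact_mod_cast n.factorial_pos
    -- The factor `n!` makes the moduli `1 + (i + 1) * d` invertible modulo each other; the other
    -- factor makes `d` nonzero and at least every `s i`, so that each `s i` is a legitimate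
    -- remainder.
    refine ⟨(n.factorial : M) * (1 + ∑ i ∈ Finset.range (n + 1), s i), ?_, fun j hj => ?_,
      fun i hi => ?_⟩
    · refine mul_ne_zero (zero_lt_one.trans_le h1).ne' ?_
      exact (zero_lt_one.trans_le le_self_add).ne'
    · refine Dvd.dvd.mul_right ?_ _
      have := Nat.dvd_factorial (Nat.succ_pos j) hj
      exact_mod_cast Nat.cast_dvd_cast (α := M) this
    · have h2 : s i ≤ ∑ i ∈ Finset.range (n + 1), s i :=
        Finset.single_le_sum (f := s) (fun _ _ => zero_le) (Finset.mem_range.2 (by omega))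
      calc s i ≤ 1 + ∑ i ∈ Finset.range (n + 1), s i := h2.trans le_add_self
        _ ≤ _ := le_mul_of_one_le_left zero_le h1
  have hm : ∀ i : ℕ, d + 1 ≤ 1 + ((i : M) + 1) * d := fun i => by
    rw [add_comm, add_mul, one_mul]; gcongr; exact le_add_self
  obtain ⟨c, hc⟩ := exists_chinese (fun i => 1 + ((i : M) + 1) * d) s
    (fun i => (zero_lt_one.trans_le (le_add_self.trans (hm i))).ne') (n + 1) (by
      intro i k hik hk
      obtain ⟨j, rfl⟩ := Nat.exists_eq_add_of_lt hik
      obtain ⟨e, he⟩ := hdvd j (by omega)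
      -- Let `k = i + j + 1`, `D = (k + 1) * d = D' + 1`, and let `mᵢ`, `mₖ = 1 + D` be the moduli.
      -- Then `(k + 1) * mᵢ = (j + 1) + (i + 1) * mₖ`, and `(j + 1) * y = D` is `-1` modulo `mₖ`. As
      -- `D * D = D' * mₖ + 1`, the inverse of `mᵢ` is `D * (k + 1) * y`.
      have hD : ((i + j + 1 : ℕ) + 1 : M) * d ≠ 0 :=
        mul_ne_zero (zero_lt_one.trans_le le_add_self).ne' hd0
      obtain ⟨D', hD'⟩ := exists_eq_add_one hD
      set y : M := ((i + j + 1 : ℕ) + 1 : M) * e with hy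
      refine ⟨(D' + 1) * ((i + j + 1 : ℕ) + 1 : M) * y, D' + (D' + 1) * ((i : M) + 1) * y, ?_⟩
      have h1 : ((j : M) + 1) * y = D' + 1 := by rw [← hD', hy, he]; ring
      have h2 : ((i + j + 1 : ℕ) + 1 : M) * (1 + ((i : M) + 1) * d) =
          ((j : M) + 1) + ((i : M) + 1) * (1 + (D' + 1)) := by
        rw [← hD']; push_cast; ring
      calc _ = (D' + 1) * y * (((i + j + 1 : ℕ) + 1 : M) * (1 + ((i : M) + 1) * d)) := by ring
        _ = (D' + 1) * (((j : M) + 1) * y) +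
            (D' + 1) * y * (((i : M) + 1) * (1 + (D' + 1))) := by rw [h2]; ring
        _ = _ := by rw [h1, hD']; ring)
  exact ⟨c, d, fun i hi => ⟨lt_of_lt_of_le (lt_add_one_iff'.2 (hlt i hi)) (hm i),
    hc i (by omega)⟩⟩

lemma exists_nat_of_lt {y : M} (n : ℕ) (h : y < n) : ∃ k : ℕ, k < n ∧ y = k := by
  induction n with
  | zero => exact absurd h (by simp)
  | succ n ih =>
    rw [Nat.cast_succ, lt_add_one_iff'] at h
    rcases h.lt_or_eq with h | h
    · obtain ⟨k, hk, rfl⟩ := ih h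
      exact ⟨k, by omega, rfl⟩
    · exact ⟨n, by omega, h⟩

/-- The definable exponential agrees with the power function at standard exponents. -/
theorem powIn_natCast_iff (x z : M) (n : ℕ) : PowIn x n z ↔ z = x ^ n := by
  constructor
  · rintro ⟨c, d, h0, hz, hs⟩
    have key : ∀ i ≤ n, BetaIn c d (i : M) (x ^ i) := by
      intro i hi
      induction i with
      | zero => simpa using h0
      | succ i ih =>
        obtain ⟨s, h1, h2⟩ := hs i (by exact_mod_cast hi)
        rw [h1.unique (ih (by omega))] at h2
        rw [Nat.cast_succ, pow_succ]
        exact h2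
    exact hz.unique (key n le_rfl)
  · rintro rfl
    obtain ⟨c, d, h⟩ := exists_beta (fun i => x ^ i) n
    refine ⟨c, d, by simpa using h 0 (by omega), h n le_rfl, fun i hi => ?_⟩
    -- Below a standard number the quantifier of the model meets only standard numbers.
    obtain ⟨k, hk, rfl⟩ := exists_nat_of_lt n hi
    refine ⟨x ^ k, h k hk.le, ?_⟩
    have := h (k + 1) hk
    rwa [Nat.cast_succ, pow_succ] at this

end Models

/-! ### Relativization and the axioms `Exp'` in a model -/

section Relativize

variable {α : Type} {n : ℕ}

lemma relativize_ex (φ : arith.BoundedFormula α (n + 1)) :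
    relativize (∃' φ) = ∼(∀' (inA (last n) ⟹ ∼(relativize φ))) := rfl

lemma relativize_not (φ : arith.BoundedFormula α n) : relativize (∼φ) = ∼(relativize φ) := rfl

lemma relativize_inf (φ ψ : arith.BoundedFormula α n) :
    relativize (φ ⊓ ψ) = relativize φ ⊓ relativize ψ := rfl

lemma relativize_eq (t u : arith.Term (α ⊕ Fin n)) :
    relativize (t =' u) = incl.onBoundedFormula (t =' u) := rfl

lemma relativize_le (t u : arith.Term (α ⊕ Fin n)) :
    relativize (le t u) = incl.onBoundedFormula (le t u) := rfl

lemma relativize_imp (φ ψ : arith.BoundedFormula α n) :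
    relativize (φ ⟹ ψ) = (relativize φ ⟹ relativize ψ) := rfl

lemma relativize_all (φ : arith.BoundedFormula α (n + 1)) :
    relativize (∀' φ) = ∀' (inA (last n) ⟹ relativize φ) := rfl

end Relativize

/-- `y` is an exponent of `e`. -/
def IsExponent {M : Type*} (e : M → M → M → Prop) (y : M) : Prop := ∃ x z, e x y z

/-- The consequences of the axioms `Exp'` for the graph `e` that are used here. -/
structure ExpAxioms {M : Type*} [CommSemiring M] [LinearOrder M] (e : M → M → M → Prop) :
    Prop where
  unique : ∀ x y z w, e x y z → e x y w → z = w
  total : ∀ x y, IsExponent e y → ∃ z, e x y z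
  zero_mem : IsExponent e 0
  one_mem : IsExponent e 1
  add_mem : ∀ x y, IsExponent e x → IsExponent e y → IsExponent e (x + y)
  pred : ∀ x, IsExponent e x → x ≠ 0 → ∃ z, IsExponent e z ∧ x = z + 1
  div : ∀ k : ℕ, 0 < k → ∀ x, IsExponent e x →
    ∃ y, IsExponent e y ∧ k * y ≤ x ∧ x < k * (y + 1)
  eq_one : ∀ x y, IsExponent e y → ((x = 1 ∨ y = 0) ↔ e x y 1)
  ne_zero : ∀ x y, IsExponent e y → x ≠ 0 → ¬ e x y 0
  one_right : ∀ x, e x 1 x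
  add_right : ∀ x y z u v, e x y u → e x z v → e x (y + z) (u * v)

section RealizeExp

variable {M : Type*} [arith.Structure M] [arithExp.Structure M]
  [incl.IsExpansionOn M] {α : Type} {n : ℕ}

@[simp] lemma realize_E (t u w : arith.Term (α ⊕ Fin n)) (v : α → M) (xs : Fin n → M) :
    (E t u w).Realize v xs ↔ ExpVal (t.realize (Sum.elim v xs)) (u.realize (Sum.elim v xs))
      (w.realize (Sum.elim v xs)) := by
  rw [E, BoundedFormula.realize_rel, ExpVal]
  refine iff_of_eq (congrArg (Structure.RelMap expRel) ?_)
  funext i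
  fin_cases i <;> simp

@[simp] lemma realize_eq (t u : arith.Term (α ⊕ Fin n)) (v : α → M) (xs : Fin n → M) :
    (eq t u).Realize v xs ↔ t.realize (Sum.elim v xs) = u.realize (Sum.elim v xs) := by
  rw [eq, LHom.realize_onBoundedFormula, BoundedFormula.realize_bdEqual]

@[simp] lemma realize_inA (t : arith.Term (α ⊕ Fin n)) (v : α → M) (xs : Fin n → M) :
    (inA t).Realize v xs ↔ IsExponent (ExpVal (M := M)) (t.realize (Sum.elim v xs)) := by
  simp [inA, IsExponent]

variable [CommSemiring M] [LinearOrder M] [ArithCompat M]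

lemma models_catalanE_iff : M ⊨ catalanE ↔ CatalanFor (ExpVal (M := M)) :=
  realize_catalan incl E _ fun _ _ _ _ _ => realize_E _ _ _ _ _

lemma expAxioms_of_models (h : M ⊨ ExpPrime) : ExpAxioms (ExpVal (M := M)) := by
  have h0 : ∀ {σ}, σ ∈ axE0 → M ⊨ σ := fun hσ => realize_of_mem h (Or.inl hσ)
  have hP : ∀ {φ}, φ ∈ presburger → M ⊨ relativize φ :=
    fun hφ => h0 (Or.inr ⟨_, hφ, rfl⟩)
  -- Two Presburger axioms are needed: existence of predecessors, and of quotients by a standard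
  -- `k`, inside the set of exponents.
  have hpred := hP (φ := ∀' (∼(&0 =' 0) ⟹ ∃' (&0 =' (&1 + 1)))) (by simp [presburger])
  have hdiv := fun (k : ℕ) (hk : 0 < k) =>
    hP (φ := ∀' ∃' (le (nmul k &1) &0 ⊓ lt &0 (nmul k (&1 + 1)))) (Or.inr ⟨k, hk, rfl⟩)
  have g1 : M ⊨ (∀' ∀' ∀' ∀' (E &0 &1 &2 ⟹ E &0 &1 &3 ⟹ eq &2 &3) : arithExp.Sentence) :=
    h0 (by simp [axE0])
  have g2 : M ⊨ (∀' ∀' (inA &1 ⟹ ∃' E &0 &1 &2) : arithExp.Sentence) := h0 (by simp [axE0])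
  have g3 : M ⊨ (inA 0 : arithExp.Sentence) := h0 (by simp [axE0])
  have g4 : M ⊨ (inA 1 : arithExp.Sentence) := h0 (by simp [axE0])
  have g5 : M ⊨ (∀' ∀' (inA &0 ⟹ inA &1 ⟹ inA (&0 + &1)) : arithExp.Sentence) :=
    h0 (by simp [axE0])
  have e1 : M ⊨ axE1 := realize_of_mem h (by simp [ExpPrime])
  have e2 : M ⊨ axE2 := realize_of_mem h (by simp [ExpPrime])
  have e3 : M ⊨ axE3 := realize_of_mem h (by simp [ExpPrime])
  have e4 : M ⊨ axE4 := realize_of_mem h (by simp [ExpPrime])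
  clear h0 hP
  simp only [lt, relativize_ex, relativize_not, relativize_inf, relativize_eq, relativize_le,
    relativize_imp, relativize_all] at hpred hdiv
  simp [Sentence.Realize, Formula.Realize, Fin.snoc, axE1, axE2, axE3, axE4] at *
  exact
    { unique := g1
      total := g2
      zero_mem := g3
      one_mem := g4
      add_mem := g5
      pred := hpred
      div := fun k hk x hx => by
        obtain ⟨y, hy, h1, h2, h3⟩ := hdiv k hk x hx
        exact ⟨y, hy, h1, lt_of_le_of_ne h2 h3⟩
      eq_one := e1
      ne_zero := e2
      one_right := e3
      add_right := e4 }

end RealizeExp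

/-! ### Catalan's conjecture for `e` from the ABC inequality -/

section Exponential

variable {M : Type*} [CommSemiring M] [LinearOrder M] {e : M → M → M → Prop}

lemma ExpAxioms.natCast (he : ExpAxioms e) (x : M) (n : ℕ) : e x n (x ^ n) := by
  induction n with
  | zero => simpa using (he.eq_one x 0 he.zero_mem).1 (Or.inr rfl)
  | succ n ih =>
    rw [Nat.cast_succ, pow_succ]
    exact he.add_right _ _ _ _ _ ih (he.one_right x)

lemma ExpAxioms.natCast_mul (he : ExpAxioms e) {x y u : M} (h : e x y u) (k : ℕ) :
    e x (k * y) (u ^ k) := by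
  induction k with
  | zero => simpa using he.natCast x 0
  | succ k ih =>
    rw [Nat.cast_succ, pow_succ, add_mul, one_mul]
    exact he.add_right _ _ _ _ _ ih h

lemma ExpAxioms.natCast_iff (he : ExpAxioms e) (x z : M) (n : ℕ) : e x n z ↔ z = x ^ n :=
  ⟨fun h => he.unique _ _ _ _ h (he.natCast x n), fun h => h ▸ he.natCast x n⟩

/-- Catalan's conjecture for standard exponents. -/
def CatalanStandard (M : Type*) [CommSemiring M] [LinearOrder M] : Prop :=
  ∀ (a b : M) (m n : ℕ), 1 < a → 1 < b → 1 < m → 1 < n → a ^ n = b ^ m + 1 →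
    a = 3 ∧ m = 3 ∧ b = 2 ∧ n = 2

lemma catalanStandard_of_catalanFor [IsStrictOrderedRing M] {G : M → M → M → Prop}
    (hG : ∀ x z (n : ℕ), G x n z ↔ z = x ^ n) (h : CatalanFor G) : CatalanStandard M := by
  intro a b m n ha hb hm hn hab
  obtain ⟨h1, h2, h3, h4⟩ := (h a b m n ha hb (by exact_mod_cast hm) (by exact_mod_cast hn)).1
    ⟨a ^ n, b ^ m, (hG _ _ _).2 rfl, (hG _ _ _).2 rfl, hab⟩
  exact ⟨h1, by exact_mod_cast h2, h3, by exact_mod_cast h4⟩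

/-- Only one implication has content; the other is the computation `3 ^ 2 = 2 ^ 3 + 1` at standard
exponents. -/
lemma catalanFor_of_forall {G : M → M → M → Prop} (hG : ∀ x z (n : ℕ), G x n z ↔ z = x ^ n)
    (h : ∀ a b m n u v : M, 1 < a → 1 < b → 1 < m → 1 < n → G a n u → G b m v → u = v + 1 →
      a = 3 ∧ m = 3 ∧ b = 2 ∧ n = 2) : CatalanFor G := by
  refine fun a b m n ha hb hm hn => ⟨fun ⟨u, v, hu, hv, huv⟩ =>
    h a b m n u v ha hb hm hn hu hv huv, ?_⟩
  rintro ⟨rfl, rfl, rfl, rfl⟩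
  exact ⟨3 ^ 2, 2 ^ 3, by exact_mod_cast (hG 3 (3 ^ 2) 2).2 rfl,
    by exact_mod_cast (hG 2 (2 ^ 3) 3).2 rfl, by norm_num⟩

lemma catalanNat_of_catalanStandard [IsStrictOrderedRing M] (h : CatalanStandard M) :
    CatalanNat := by
  intro a b m n ha hb hm hn
  constructor
  · intro hab
    obtain ⟨h1, h2, h3, h4⟩ := h a b m n (by exact_mod_cast ha) (by exact_mod_cast hb) hm hn
      (by exact_mod_cast congrArg (Nat.cast (R := M)) hab)
    exact ⟨by exact_mod_cast h1, h2, by exact_mod_cast h3, h4⟩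
  · rintro ⟨rfl, rfl, rfl, rfl⟩
    norm_num

variable [arith.Structure M] [ArithModel M]

lemma one_le_of_ne_zero {x : M} (hx : x ≠ 0) : 1 ≤ x := by
  simpa using add_one_le_iff'.2 (pos_iff_ne_zero.2 hx)

lemma two_le_of_one_lt {x : M} (hx : 1 < x) : 2 ≤ x := by
  rw [← one_add_one_eq_two]; exact add_one_le_iff'.2 hx

lemma PrimeIn.dvd_of_dvd_pow {p x : M} (hp : PrimeIn p) {k : ℕ} (h : p ∣ x ^ k) : p ∣ x := by
  induction k with
  | zero =>
    rw [pow_zero] at h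
    exact absurd (le_of_dvd' one_ne_zero h) (not_le.2 hp.1)
  | succ k ih =>
    rw [pow_succ] at h
    exact (hp.dvd_or_dvd h).elim ih id

/-- The radical of `X` is at most the `k`-th root of `X`. -/
def SmallRad (k : ℕ) (X : M) : Prop :=
  ∃ U, U ≠ 0 ∧ (∀ p, PrimeIn p → p ∣ X → p ∣ U) ∧ U ^ k ≤ X

lemma smallRad_pow {x : M} (hx : 1 < x) {k n : ℕ} (h : k ≤ n) : SmallRad k (x ^ n) :=
  ⟨x, (zero_lt_one.trans hx).ne', fun _ hp h => hp.dvd_of_dvd_pow h, pow_le_pow_right₀ hx.le h⟩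

/-- Powers with a nonstandard exponent are large and have small radicals. -/
lemma ExpAxioms.smallRad (he : ExpAxioms e) {a n X : M} (ha : 1 < a) (h : e a n X)
    (hn : ∀ j : ℕ, n ≠ j) {k : ℕ} (hk : 0 < k) : SmallRad k X ∧ 2 ^ k ≤ X := by
  obtain ⟨q, hq, hle, hlt⟩ := he.div k hk n ⟨a, X, h⟩
  obtain ⟨r, rfl⟩ := exists_add_of_le hle
  rw [mul_add, mul_one] at hlt
  -- The remainder lies below the standard `k`, so it is standard. Hence `q ≠ 0`, as `n` is not.
  obtain ⟨j, -, rfl⟩ := exists_nat_of_lt k (lt_of_add_lt_add_left hlt)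
  have hq0 : q ≠ 0 := by
    rintro rfl
    exact hn j (by simp)
  -- Splitting off one unit makes `a` a factor of `e(a, q) = U * a`, so that the primes of `a ^ j`
  -- divide it, too.
  obtain ⟨z, hz, rfl⟩ := he.pred q hq hq0
  obtain ⟨U, hU⟩ := he.total a z hz
  have hUa : e a (z + 1) (U * a) := he.add_right _ _ _ _ _ hU (he.one_right a)
  obtain rfl : X = (U * a) ^ k * a ^ j :=
    he.unique _ _ _ _ h (he.add_right _ _ _ _ _ (he.natCast_mul hUa k) (he.natCast a j))
  have ha0 : a ≠ 0 := (zero_lt_one.trans ha).ne'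
  have hU0 : U * a ≠ 0 := by
    intro h0
    rw [h0] at hUa
    exact he.ne_zero _ _ hq ha0 hUa
  have hU1 : U * a ≠ 1 := by
    intro h1
    rw [h1] at hUa
    exact ((he.eq_one _ _ hq).2 hUa).elim ha.ne' hq0
  have hpow : (U * a) ^ k ≤ (U * a) ^ k * a ^ j :=
    le_mul_of_one_le_right zero_le (one_le_pow₀ ha.le)
  refine ⟨⟨U * a, hU0, fun p hp hpX => ?_, hpow⟩, le_trans ?_ hpow⟩
  · rcases hp.dvd_or_dvd hpX with h | h
    · exact hp.dvd_of_dvd_pow h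
    · exact (hp.dvd_of_dvd_pow h).mul_left U
  -- By (e1) and (e2), `U * a` is neither `1` nor `0`, so it is at least `2`.
  · exact pow_le_pow_left₀ zero_le
      (two_le_of_one_lt (lt_of_le_of_ne (one_le_of_ne_zero hU0) hU1.symm)) k

/-- The ABC inequality bounds consecutive numbers with small radicals. -/
lemma lt_of_smallRad {K : ℕ} (hK : M ⊨ abc K) {X Y : M} (hXY : X = Y + 1) (hY : Y ≠ 0)
    (h : SmallRad 2 X ∧ SmallRad 8 Y ∨ SmallRad 8 X ∧ SmallRad 2 Y) : X < (K : M) ^ 6 := by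
  have hX : X ≠ 0 := by rw [hXY]; exact (zero_lt_one.trans_le le_add_self).ne'
  have hle : Y ≤ X := by rw [hXY]; exact le_self_add
  -- The exponents `2` and `8` give `rad(X Y) ≤ X ^ (1/2 + 1/8) = X ^ (5/8)`, and `4/3 * 5/8 = 5/6`
  -- is less than `1`.
  obtain ⟨U, V, hU0, hV0, hU, hV, hUV⟩ : ∃ U V : M, U ≠ 0 ∧ V ≠ 0 ∧
      (∀ p, PrimeIn p → p ∣ X → p ∣ U) ∧ (∀ p, PrimeIn p → p ∣ Y → p ∣ V) ∧
      (U * V) ^ 8 ≤ X ^ 5 := by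
    have aux : ∀ u v : M, u ^ 2 ≤ X → v ^ 8 ≤ X → (u * v) ^ 8 ≤ X ^ 5 := by
      intro u v hu hv
      calc (u * v) ^ 8 = (u ^ 2) ^ 4 * v ^ 8 := by ring
        _ ≤ X ^ 4 * X := mul_le_mul' (pow_le_pow_left₀ zero_le hu 4) hv
        _ = X ^ 5 := by ring
    rcases h with ⟨⟨U, hU0, hU, hUX⟩, V, hV0, hV, hVY⟩ | ⟨⟨U, hU0, hU, hUX⟩, V, hV0, hV, hVY⟩
    · exact ⟨U, V, hU0, hV0, hU, hV, aux U V hUX (hVY.trans hle)⟩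
    · exact ⟨U, V, hU0, hV0, hU, hV, by rw [mul_comm]; exact aux V U (hVY.trans hle) hUX⟩
  obtain ⟨r, hr, hmin⟩ := exists_rad (x := Y * 1 * X) (by simp [hX, hY])
  have hrUV : r ≤ U * V := by
    refine hmin _ (mul_ne_zero hU0 hV0) fun p hp hpx => ?_
    rw [mul_one] at hpx
    rcases hp.dvd_or_dvd hpx with h | h
    · exact (hV p hp h).mul_left U
    · exact (hU p hp h).mul_right V
  -- ABC for `Y + 1 = X`, where coprimality is automatic.
  have habc := (realize_abc_iff K).1 hK Y 1 X r (pos_iff_ne_zero.2 hY) zero_lt_one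
    (pos_iff_ne_zero.2 hX)
    (fun d _ hd _ => le_antisymm (le_of_dvd' one_ne_zero hd)
      (one_le_of_ne_zero (ne_zero_of_dvd_ne_zero one_ne_zero hd))) hXY.symm hr
  -- Squaring the inequality turns `r ^ 4` into `r ^ 8`, which is at most `X ^ 5`.
  have h6 : X * X ^ 5 < (K : M) ^ 6 * X ^ 5 := by
    calc X * X ^ 5 = (X ^ 3) ^ 2 := by ring
      _ < ((K : M) ^ 3 * r ^ 4) ^ 2 := pow_lt_pow_left₀ habc zero_le two_ne_zero
      _ = (K : M) ^ 6 * r ^ 8 := by ring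
      _ ≤ (K : M) ^ 6 * (U * V) ^ 8 := mul_le_mul' le_rfl (pow_le_pow_left₀ zero_le hrUV 8)
      _ ≤ _ := mul_le_mul' le_rfl hUV
  exact lt_of_mul_lt_mul_right h6 zero_le

theorem ExpAxioms.eq_of_catalan (he : ExpAxioms e) {K : ℕ} (hK : M ⊨ abc K)
    (hcat : CatalanStandard M) {a b m n X Y : M} (ha : 1 < a) (hb : 1 < b) (hm : 1 < m)
    (hn : 1 < n) (hX : e a n X) (hY : e b m Y) (hXY : X = Y + 1) :
    a = 3 ∧ m = 3 ∧ b = 2 ∧ n = 2 := by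
  have hY0 : Y ≠ 0 := by
    rintro rfl
    exact he.ne_zero _ _ ⟨_, _, hY⟩ (zero_lt_one.trans hb).ne' hY
  have hle : Y ≤ X := by rw [hXY]; exact le_self_add
  have hstd : ∀ {a n X : M}, 1 < a → 1 < n → e a n X → SmallRad 2 X := by
    intro a n X ha hn hX
    by_cases hj : ∃ j : ℕ, n = j
    · obtain ⟨j, rfl⟩ := hj
      obtain rfl := (he.natCast_iff _ _ _).1 hX
      exact smallRad_pow ha (by exact_mod_cast hn)
    · push Not at hj
      exact (he.smallRad ha hX hj two_pos).1
  -- A nonstandard exponent forces both inequalities. The lower bound is taken at `k = K ^ 6 + 1`,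
  -- positive even for `K = 0`.
  have hbig : ¬ 2 ^ (K ^ 6 + 1) ≤ X ∨ ¬ X < (K : M) ^ 6 := by
    by_contra! h
    have h1 : (2 : M) ^ (K ^ 6 + 1) < (K : M) ^ 6 := h.1.trans_lt h.2
    have h2 : 2 ^ (K ^ 6 + 1) < K ^ 6 := by exact_mod_cast h1
    exact absurd h2 (not_lt.2 ((Nat.lt_two_pow_self).le.trans
      (Nat.pow_le_pow_right two_pos (Nat.le_succ _))))
  by_cases hns : ∀ j : ℕ, n ≠ j
  · refine (hbig.elim (· ?_) (· ?_)).elim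
    · exact (he.smallRad ha hX hns (Nat.succ_pos _)).2
    · exact lt_of_smallRad hK hXY hY0
        (Or.inr ⟨(he.smallRad ha hX hns (by norm_num)).1, hstd hb hm hY⟩)
  by_cases hms : ∀ j : ℕ, m ≠ j
  · refine (hbig.elim (· ?_) (· ?_)).elim
    · exact (he.smallRad hb hY hms (Nat.succ_pos _)).2.trans hle
    · exact lt_of_smallRad hK hXY hY0
        (Or.inl ⟨hstd ha hn hX, (he.smallRad hb hY hms (by norm_num)).1⟩)
  push Not at hns hms
  obtain ⟨n, rfl⟩ := hns
  obtain ⟨m, rfl⟩ := hms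
  rw [he.natCast_iff] at hX hY
  rw [hX, hY] at hXY
  obtain ⟨h1, rfl, h3, rfl⟩ := hcat a b m n ha hb (by exact_mod_cast hm) (by exact_mod_cast hn) hXY
  exact ⟨h1, by norm_num, h3, by norm_num⟩

end Exponential

/-! ### The standard model and `Th(ℕ)` -/

section Standard

instance : ArithModel ℕ where
  lt_one x hx := by omega
  models := by
    refine (Theory.model_union_iff).2 ⟨models_robinson_iff.2 ⟨by simp, by simp, by simp,
      fun x hx => ⟨x - 1, by omega⟩, by simp, fun x y => by omega, by simp, fun x y => by ring,
      fun x y => ⟨fun h => ⟨y - x, by omega⟩, ?_⟩⟩, ?_⟩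
    · rintro ⟨z, rfl⟩; omega
    · refine (Theory.model_iff _).2 ?_
      rintro _ ⟨k, φ, -, rfl⟩
      refine (models_induction_iff φ).2 fun v h0 h1 x => ?_
      induction x with
      | zero => exact h0
      | succ x ih => exact h1 x ih

lemma primeIn_nat_iff {p : ℕ} : PrimeIn p ↔ p.Prime := by
  rw [Nat.prime_def]; rfl

lemma RadIn.eq_radical {r x : ℕ} (h : RadIn r x) (hx : x ≠ 0) :
    r = UniqueFactorizationMonoid.radical x := by
  have hsq : Squarefree r := fun t ht => Nat.isUnit_iff.2 (h.1 t ht)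
  rw [Nat.radical_eq_prod_primeFactors]
  have : r.primeFactors = x.primeFactors := by
    ext p
    simp only [Nat.mem_primeFactors, ne_eq, hsq.ne_zero, not_false_eq_true, and_true, hx]
    exact and_congr_right fun hp => h.2 p (primeIn_nat_iff.2 hp)
  rw [← this, Nat.prod_primeFactors_of_squarefree hsq]

lemma models_abc_nat {K : ℕ} (h : AbcNat K) : ℕ ⊨ abc K := by
  rw [realize_abc_iff]
  intro a b c r ha hb hc hcop habc hr
  rw [hr.eq_radical (by positivity)]
  have hab : Nat.Coprime a b := hcop _ (Nat.gcd_dvd_left a b) (Nat.gcd_dvd_right a b)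
    (habc ▸ dvd_add (Nat.gcd_dvd_left a b) (Nat.gcd_dvd_right a b))
  have hlt := h a b c ha hb hab habc
  set R := UniqueFactorizationMonoid.radical (a * b * c)
  have hpow : (((R : ℕ) : ℝ) ^ (1 + 1 / 3 : ℝ)) ^ 3 = ((R : ℕ) : ℝ) ^ 4 := by
    rw [← Real.rpow_natCast, ← Real.rpow_mul (Nat.cast_nonneg _), ← Real.rpow_natCast]
    norm_num
  have h3 : (c : ℝ) ^ 3 < K ^ 3 * ((R : ℕ) : ℝ) ^ 4 := by
    rw [← hpow, ← mul_pow]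
    exact pow_lt_pow_left₀ hlt (Nat.cast_nonneg _) three_ne_zero
  exact_mod_cast h3

lemma models_catalanDef_nat (h : CatalanNat) : ℕ ⊨ catalanDef := by
  have hpow : ∀ x z n : ℕ, PowIn x n z ↔ z = x ^ n := fun x z n => by
    simpa using powIn_natCast_iff x z n
  rw [models_catalanDef_iff]
  refine catalanFor_of_forall (by simpa using hpow) fun a b m n u v ha hb hm hn hu hv huv => ?_
  rw [hpow] at hu hv
  exact (h a b m n ha hb hm hn).1 (by rw [← hu, ← hv, huv])

lemma admissible_completeTheory {K : ℕ} (hK : AbcNat K) (h : CatalanNat) :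
    Admissible (arith.completeTheory ℕ) := by
  have mem : ∀ {φ : arith.Sentence}, ℕ ⊨ φ → arith.completeTheory ℕ ⊨ᵇ φ :=
    fun hφ => Theory.models_sentence_of_mem hφ
  exact ⟨fun φ hφ => mem (realize_of_mem ArithModel.models hφ), ⟨K, mem (models_abc_nat hK)⟩,
    mem (models_catalanDef_nat h)⟩

end Standard

theorem exists_arithModel_of_models {M : Type*} [arith.Structure M] (h : M ⊨ ISigma1) :
    ∃ (_ : CommSemiring M) (_ : LinearOrder M), ArithModel M := by
  let _ : Zero M := ⟨Structure.funMap zeroFunc ![]⟩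
  let _ : One M := ⟨Structure.funMap oneFunc ![]⟩
  let _ : Add M := ⟨fun x y => Structure.funMap addFunc ![x, y]⟩
  let _ : Mul M := ⟨fun x y => Structure.funMap mulFunc ![x, y]⟩
  let _ : LE M := ⟨fun x y => Structure.RelMap leRel ![x, y]⟩
  have h2 : ∀ v : Fin 2 → M, v = ![v 0, v 1] := fun v => by
    funext i; fin_cases i <;> rfl
  have : ArithCompat M :=
    { funMap_zero := fun v => congrArg _ (Subsingleton.elim _ _)
      funMap_one := fun v => congrArg _ (Subsingleton.elim _ _)
      funMap_add := fun v => congrArg _ (h2 v)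
      funMap_mul := fun v => congrArg _ (h2 v)
      relMap_le := fun v => iff_of_eq (congrArg _ (h2 v)) }
  exact exists_arithModel h

/-! ### Substructures of models -/

section Substructures

variable {M : Type*} [arith.Structure M] [arithExp.Structure M] [incl.IsExpansionOn M]

/-- Catalan's conjecture for `e` in a substructure, in terms of the values of `e` in the model. -/
lemma substructure_catalanE [CommSemiring M] [LinearOrder M] [ArithModel M]
    (he : ExpAxioms (ExpVal (M := M))) (N : arithExp.Substructure M) :
    ((∀ a b m n u v : M, 1 < a → 1 < b → 1 < m → 1 < n → ExpVal a n u → ExpVal b m v →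
      u = v + 1 → a = 3 ∧ m = 3 ∧ b = 2 ∧ n = 2) → N ⊨ catalanE) ∧
    (N ⊨ catalanE → CatalanNat) := by
  have funMap_mem : ∀ {k} (f : arith.Functions k) (v : Fin k → M), (∀ i, v i ∈ N) →
      Structure.funMap f v ∈ N := fun f v hv => by
    rw [← LHom.map_onFunction incl f v]
    exact N.fun_mem _ v hv
  -- A substructure need not satisfy `IΣ₁`; only its inherited ordered semiring structure is used.
  let S : Subsemiring M :=
    { carrier := N
      zero_mem' := SetLike.mem_coe.2 <| by
        simpa only [ArithCompat.funMap_zero] using funMap_mem zeroFunc ![] (by simp)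
      one_mem' := SetLike.mem_coe.2 <| by
        simpa only [ArithCompat.funMap_one] using funMap_mem oneFunc ![] (by simp)
      add_mem' := fun {x y} hx hy => by
        have := funMap_mem addFunc ![x, y]
          (by intro i; fin_cases i; exacts [hx, hy])
        simpa [ArithCompat.funMap_add] using this
      mul_mem' := fun {x y} hx hy => by
        have := funMap_mem mulFunc ![x, y]
          (by intro i; fin_cases i; exacts [hx, hy])
        simpa [ArithCompat.funMap_mul] using this }
  let _ : CommSemiring N := inferInstanceAs (CommSemiring S)
  let _ : LinearOrder N := inferInstanceAs (LinearOrder S)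
  have : IsStrictOrderedRing N := inferInstanceAs (IsStrictOrderedRing S)
  let _ : arith.Structure N := incl.reduct N
  have : incl.IsExpansionOn N := LHom.isExpansionOn_reduct _ _
  have coe_funMap : ∀ {k} (f : arith.Functions k) (v : Fin k → N),
      ((Structure.funMap f v : N) : M) = Structure.funMap f fun i => (v i : M) :=
    fun f v => LHom.map_onFunction incl f _
  have : ArithCompat N :=
    { funMap_zero := fun v => Subtype.ext ((coe_funMap _ v).trans (ArithCompat.funMap_zero _))
      funMap_one := fun v => Subtype.ext ((coe_funMap _ v).trans (ArithCompat.funMap_one _))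
      funMap_add := fun v => Subtype.ext ((coe_funMap _ v).trans (ArithCompat.funMap_add _))
      funMap_mul := fun v => Subtype.ext ((coe_funMap _ v).trans (ArithCompat.funMap_mul _))
      relMap_le := fun v =>
        (iff_of_eq (LHom.map_onRelation incl leRel fun i => (v i : M))).trans
          (ArithCompat.relMap_le _) }
  let ι : N →+* M := S.subtype
  have hι : ∀ x : N, ι x = x := fun _ => rfl
  have hinj : Function.Injective ι := Subtype.coe_injective
  have hlt : ∀ {x : N}, 1 < x → (1 : M) < x := fun h => h
  have hval : ∀ x y z : N, ExpVal x y z ↔ ExpVal (x : M) y z := fun x y z => by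
    change Structure.RelMap expRel (fun i => ((![x, y, z] i : N) : M)) ↔ _
    refine iff_of_eq (congrArg (Structure.RelMap (M := M) expRel) ?_)
    funext i
    fin_cases i <;> rfl
  -- The graph on `N` is the restriction of the one on `M`, and `N` contains all standard powers of
  -- its elements.
  have hpow : ∀ (x z : N) (n : ℕ), ExpVal x n z ↔ z = x ^ n := fun x z n => by
    rw [hval, ← hι x, ← hι z, ← hι n, map_natCast, he.natCast_iff, ← map_pow, hinj.eq_iff]
  rw [models_catalanE_iff]
  refine ⟨fun h => catalanFor_of_forall hpow fun a b m n u v ha hb hm hn hu hv huv => ?_,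
    fun h => catalanNat_of_catalanStandard (catalanStandard_of_catalanFor hpow h)⟩
  obtain ⟨h1, h2, h3, h4⟩ := h a b m n u v (hlt ha) (hlt hb) (hlt hm) (hlt hn)
    ((hval _ _ _).1 hu) ((hval _ _ _).1 hv) (congrArg ι huv)
  have h2' : ι 2 = 2 := map_ofNat ι 2
  have h3' : ι 3 = 3 := map_ofNat ι 3
  exact ⟨hinj (h1.trans h3'.symm), hinj (h2.trans h3'.symm), hinj (h3.trans h2'.symm),
    hinj (h4.trans h2'.symm)⟩

end Substructures

/-! ### Both parts of the theorem, model by model -/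

section Models

variable {M : Type*} [arithExp.Structure M] {S : arith.Theory}

theorem models_catalanE_of_admissible (hS : Admissible S) (h : M ⊨ plusExp S) :
    M ⊨ catalanE ∧ ∀ N : arithExp.Substructure M, N ⊨ catalanE := by
  let _ : arith.Structure M := incl.reduct M
  have : incl.IsExpansionOn M := LHom.isExpansionOn_reduct _ _
  have hM : M ⊨ S := (LHom.onTheory_model incl S).1 (h.mono Set.subset_union_left)
  have : Nonempty M := ⟨Structure.funMap zeroFunc ![]⟩
  obtain ⟨hI, ⟨K, hK⟩, hcat⟩ := hS
  obtain ⟨_, _, _⟩ := exists_arithModel_of_models (M := M)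
    ((Theory.model_iff _).2 fun φ hφ => (hI φ hφ).realize_sentence M)
  have he : ExpAxioms (ExpVal (M := M)) := expAxioms_of_models (h.mono Set.subset_union_right)
  have hst : CatalanStandard M := catalanStandard_of_catalanFor powIn_natCast_iff
    (models_catalanDef_iff.1 (hcat.realize_sentence M))
  have key : ∀ a b m n u v : M, 1 < a → 1 < b → 1 < m → 1 < n → ExpVal a n u → ExpVal b m v →
      u = v + 1 → a = 3 ∧ m = 3 ∧ b = 2 ∧ n = 2 := fun a b m n u v ha hb hm hn =>
    he.eq_of_catalan (hK.realize_sentence M) hst ha hb hm hn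
  exact ⟨models_catalanE_iff.2 (catalanFor_of_forall he.natCast_iff key),
    fun N => (substructure_catalanE he N).1 key⟩

/-- Instances of Catalan's conjecture in `ℕ` are those for `e` at standard arguments, where `e` is
the power function. -/
theorem catalanNat_of_models_catalanE (h : M ⊨ plusExp (arith.completeTheory ℕ)) :
    (M ⊨ catalanE → CatalanNat) ∧ ∀ N : arithExp.Substructure M, N ⊨ catalanE → CatalanNat := by
  let _ : arith.Structure M := incl.reduct M
  have : incl.IsExpansionOn M := LHom.isExpansionOn_reduct _ _
  have hM : M ⊨ arith.completeTheory ℕ :=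
    (LHom.onTheory_model incl _).1 (h.mono Set.subset_union_left)
  obtain ⟨_, _, _⟩ := exists_arithModel_of_models (M := M)
    ((Theory.model_iff _).2 fun φ hφ =>
      realize_of_mem hM (realize_of_mem (ArithModel.models (M := ℕ)) hφ))
  have he : ExpAxioms (ExpVal (M := M)) := expAxioms_of_models (h.mono Set.subset_union_right)
  exact ⟨fun hc => catalanNat_of_catalanStandard
    (catalanStandard_of_catalanFor he.natCast_iff (models_catalanE_iff.1 hc)),
    fun N => (substructure_catalanE he N).2⟩

end Models

end WeakExp

theorem theorem5p2 :
    -- Catalan's conjecture for `e` is provable in `S + Exp'`, and it also holds in every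
    -- substructure of a model of `S + Exp'` on which `e` is total
    (∀ S : WeakExp.arith.Theory, WeakExp.Admissible S →
      WeakExp.plusExp S ⊨ᵇ WeakExp.catalanE ∧
      ∀ (M : Type*) [WeakExp.arithExp.Structure M], M ⊨ WeakExp.plusExp S →
        ∀ N : WeakExp.arithExp.Substructure M, WeakExp.ExpTotalOn N → N ⊨ WeakExp.catalanE) ∧
    -- the case of `Th(ℕ)`, assuming the ABC inequality in `ℕ`
    ((∃ K : ℕ, WeakExp.AbcNat K) →
      ∀ (M : Type*) [WeakExp.arithExp.Structure M],
        M ⊨ WeakExp.plusExp (WeakExp.arith.completeTheory ℕ) →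
        (M ⊨ WeakExp.catalanE ↔ WeakExp.CatalanNat) ∧
        ∀ N : WeakExp.arithExp.Substructure M, WeakExp.ExpTotalOn N →
          (N ⊨ WeakExp.catalanE ↔ WeakExp.CatalanNat)) := by
  refine ⟨fun S hS => ⟨?_, fun M _ hM N _ =>
    (WeakExp.models_catalanE_of_admissible hS hM).2 N⟩, ?_⟩
  · exact FirstOrder.Language.Theory.models_sentence_iff.2 fun M =>
      (WeakExp.models_catalanE_of_admissible hS M.is_model).1
  · rintro ⟨K, hK⟩ M _ hM
    have hcat := WeakExp.catalanNat_of_models_catalanE hM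
    exact ⟨⟨hcat.1, fun h => (WeakExp.models_catalanE_of_admissible
        (WeakExp.admissible_completeTheory hK h) hM).1⟩,
      fun N _ => ⟨hcat.2 N, fun h => (WeakExp.models_catalanE_of_admissible
        (WeakExp.admissible_completeTheory hK h) hM).2 N⟩⟩
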